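/- Let $n\ge 3$, let $M$ be a smooth $n$-dimensional manifold without boundary, let $\rho\in\mathbb R$, and let $g(t)$, $t\in J$, be a family of Riemannian metrics on $M$, smooth in space and time, on an interval $J\subset\mathbb R$ with more than one point (for instance $J=[0,T)$), which solves the Ricci–Bourguignon (RB) flow $$\frac{\partial}{\partial t}g=-2\,\mathrm{Ric}+2\rho\,\mathrm R\,g .$$ (At an end point of $J$ that belongs to $J$, time derivatives are one-sided.) Conventions: $\mathrm{Riem}(X,Y)Z=\nabla_Y\nabla_XZ-\nabla_X\nabla_YZ+\nabla_{[X,Y]}Z$; in local coordinates $\mathrm R^l_{ijk}\partial_l=\mathrm{Riem}(\partial_i,\partial_j)\partial_k$, $\mathrm R_{ijkl}=g_{lm}\mathrm R^m_{ijk}$, $\mathrm R_{ik}=g^{jl}\mathrm R_{ijkl}$, $\mathrm R=g^{ik}\mathrm R_{ik}$; $(\mathrm{Ric}^2)_{ab}=g^{pq}\mathrm R_{ap}\mathrm R_{bq}$, $|\mathrm{Ric}|^2=g^{ik}g^{jl}\mathrm R_{ij}\mathrm R_{kl}$; $\Delta=g^{pq}\nabla_p\nabla_q$ is the rough Laplacian;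 the Kulkarni–Nomizu product of symmetric bilinear forms is $$(p\odot q)_{ijkl}=p_{ik}q_{jl}+p_{jl}q_{ik}-p_{il}q_{jk}-p_{jk}q_{il};$$ the Weyl tensor is $$\mathrm W_{ijkl}=\mathrm R_{ijkl}+\frac{\mathrm R}{(n-1)(n-2)}(g_{ik}g_{jl}-g_{il}g_{jk})-\frac1{n-2}(\mathrm R_{ik}g_{jl}-\mathrm R_{il}g_{jk}+\mathrm R_{jl}g_{ik}-\mathrm R_{jk}g_{il}),$$ and $\mathrm B(\mathrm W)_{ijkl}=g^{pq}g^{rs}\mathrm W_{ipjr}\mathrm W_{kqls}$. Then in every smooth coordinate chart of $M$, at every point of the chart and every $t\in J$, the components of the Weyl tensor of $g(t)$ are differentiable in time and $$\begin{aligned} \frac{\partial}{\partial t}\mathrm W_{ijkl}={}&\Delta\mathrm W_{ijkl}+2\big(\mathrm B(\mathrm W)_{ijkl}-\mathrm B(\mathrm W)_{ijlk}-\mathrm B(\mathrm W)_{iljk}+\mathrm B(\mathrm W)_{ikjl}\big)\\ &+2\rho\,\mathrm R\,\mathrm W_{ijkl}-g^{pq}\big(\mathrm W_{pjkl}\mathrm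 R_{qi}+\mathrm W_{ipkl}\mathrm R_{qj}+\mathrm W_{ijpl}\mathrm R_{qk}+\mathrm W_{ijkp}\mathrm R_{ql}\big)\\ &+\frac{2}{(n-2)^2}(\mathrm{Ric}^2\odot g)_{ijkl}+\frac1{n-2}(\mathrm{Ric}\odot\mathrm{Ric})_{ijkl}\\ &-\frac{2\mathrm R}{(n-2)^2}(\mathrm{Ric}\odot g)_{ijkl}+\frac{\mathrm R^2-|\mathrm{Ric}|^2}{(n-1)(n-2)^2}(g\odot g)_{ijkl}. \end{aligned}$$ -/

import Mathlib

open scoped Manifold ContDiff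

noncomputable section

namespace RBFlow

/-! ### Riemannian geometry in a coordinate domain

Throughout, `G : EuclideanSpace ℝ (Fin n) → Matrix (Fin n) (Fin n) ℝ` is the field of components
`g_ij` of a Riemannian metric in some coordinate system, and `(G y)⁻¹` has components `g^ij`.
A covariant tensor field of order `r` is given by its components, a function of the point and of a
multi-index `Fin r → Fin n`. -/

variable {n : ℕ}

/-- The partial derivative `∂f/∂x^k` at `y`. -/
def pd (k : Fin n) (f : EuclideanSpace ℝ (Fin n) → ℝ) (y : EuclideanSpace ℝ (Fin n)) : ℝ :=
  fderiv ℝ f y (EuclideanSpace.single k 1)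

/-- The Christoffel symbols `Γ^k_ij = ½ g^kl (∂_i g_jl + ∂_j g_il - ∂_l g_ij)` of the Levi-Civita
connection. -/
def christoffel (G : EuclideanSpace ℝ (Fin n) → Matrix (Fin n) (Fin n) ℝ)
    (k i j : Fin n) (y : EuclideanSpace ℝ (Fin n)) : ℝ :=
  (1 / 2) * ∑ l, (G y)⁻¹ k l *
    (pd i (fun z => G z j l) y + pd j (fun z => G z i l) y - pd l (fun z => G z i j) y)

/-- The components `R^l_ijk` of the curvature tensor, with the sign convention
`Riem(X,Y)Z = ∇_Y ∇_X Z - ∇_X ∇_Y Z + ∇_[X,Y] Z` and `R^l_ijk ∂_l = Riem(∂_i, ∂_j) ∂_k`. -/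
def riemUp (G : EuclideanSpace ℝ (Fin n) → Matrix (Fin n) (Fin n) ℝ)
    (y : EuclideanSpace ℝ (Fin n)) (l i j k : Fin n) : ℝ :=
  pd j (christoffel G l i k) y - pd i (christoffel G l j k) y
    + ∑ m, (christoffel G m i k y * christoffel G l j m y
        - christoffel G m j k y * christoffel G l i m y)

/-- The Riemann tensor `R_ijkl = g_lm R^m_ijk`. -/
def riem (G : EuclideanSpace ℝ (Fin n) → Matrix (Fin n) (Fin n) ℝ)
    (y : EuclideanSpace ℝ (Fin n)) (i j k l : Fin n) : ℝ :=
  ∑ m, G y l m * riemUp G y m i j k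

/-- The Ricci tensor `R_ik = g^jl R_ijkl`. -/
def ric (G : EuclideanSpace ℝ (Fin n) → Matrix (Fin n) (Fin n) ℝ)
    (y : EuclideanSpace ℝ (Fin n)) : Matrix (Fin n) (Fin n) ℝ :=
  fun i k => ∑ j, ∑ l, (G y)⁻¹ j l * riem G y i j k l

/-- The scalar curvature `R = g^ik R_ik`. -/
def scal (G : EuclideanSpace ℝ (Fin n) → Matrix (Fin n) (Fin n) ℝ)
    (y : EuclideanSpace ℝ (Fin n)) : ℝ :=
  ∑ i, ∑ k, (G y)⁻¹ i k * ric G y i k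

/-- `(Ric²)_ab = g^pq R_ap R_bq`. -/
def ricSq (G : EuclideanSpace ℝ (Fin n) → Matrix (Fin n) (Fin n) ℝ)
    (y : EuclideanSpace ℝ (Fin n)) : Matrix (Fin n) (Fin n) ℝ :=
  fun a b => ∑ p, ∑ q, (G y)⁻¹ p q * ric G y a p * ric G y b q

/-- `|Ric|² = g^ik g^jl R_ij R_kl`. -/
def normRicSq (G : EuclideanSpace ℝ (Fin n) → Matrix (Fin n) (Fin n) ℝ)
    (y : EuclideanSpace ℝ (Fin n)) : ℝ :=
  ∑ i, ∑ j, ∑ k, ∑ l, (G y)⁻¹ i k * (G y)⁻¹ j l * ric G y i j * ric G y k l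

/-- The Weyl tensor, through the decomposition of the Riemann tensor (`n ≥ 3`). -/
def weyl (G : EuclideanSpace ℝ (Fin n) → Matrix (Fin n) (Fin n) ℝ)
    (y : EuclideanSpace ℝ (Fin n)) (i j k l : Fin n) : ℝ :=
  riem G y i j k l
    + scal G y / (((n : ℝ) - 1) * ((n : ℝ) - 2)) * (G y i k * G y j l - G y i l * G y j k)
    - 1 / ((n : ℝ) - 2) * (ric G y i k * G y j l - ric G y i l * G y j k
        + ric G y j l * G y i k - ric G y j k * G y i l)

/-- The Weyl tensor as a covariant tensor field of order four. -/
def weylField (G : EuclideanSpace ℝ (Fin n) → Matrix (Fin n) (Fin n) ℝ)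
    (y : EuclideanSpace ℝ (Fin n)) (a : Fin 4 → Fin n) : ℝ :=
  weyl G y (a 0) (a 1) (a 2) (a 3)

/-- The Kulkarni–Nomizu product of two symmetric bilinear forms. -/
def kulkarniNomizu (p q : Matrix (Fin n) (Fin n) ℝ) (i j k l : Fin n) : ℝ :=
  p i k * q j l + p j l * q i k - p i l * q j k - p j k * q i l

/-- `B(W)_ijkl = g^pq g^rs W_ipjr W_kqls`. -/
def weylB (G : EuclideanSpace ℝ (Fin n) → Matrix (Fin n) (Fin n) ℝ)
    (y : EuclideanSpace ℝ (Fin n)) (i j k l : Fin n) : ℝ :=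
  ∑ p, ∑ q, ∑ r, ∑ s, (G y)⁻¹ p q * (G y)⁻¹ r s * weyl G y i p j r * weyl G y k q l s

/-- The covariant derivative `∇T` of a covariant tensor field of order `r`; the direction of
differentiation is the first index:
`(∇T)_{c a₁…a_r} = ∇_c T_{a₁…a_r} = ∂_c T_{a₁…a_r} - ∑_s Γ^m_{c a_s} T_{a₁…m…a_r}`. -/
def covDeriv (G : EuclideanSpace ℝ (Fin n) → Matrix (Fin n) (Fin n) ℝ) {r : ℕ}
    (T : EuclideanSpace ℝ (Fin n) → (Fin r → Fin n) → ℝ)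
    (y : EuclideanSpace ℝ (Fin n)) (a : Fin (r + 1) → Fin n) : ℝ :=
  pd (a 0) (fun z => T z (Fin.tail a)) y
    - ∑ s : Fin r, ∑ m : Fin n,
        christoffel G m (a 0) (Fin.tail a s) y * T y (Function.update (Fin.tail a) s m)

/-- The rough Laplacian `ΔT = g^pq ∇_p ∇_q T` of a covariant tensor field. -/
def laplacian (G : EuclideanSpace ℝ (Fin n) → Matrix (Fin n) (Fin n) ℝ) {r : ℕ}
    (T : EuclideanSpace ℝ (Fin n) → (Fin r → Fin n) → ℝ)
    (y : EuclideanSpace ℝ (Fin n)) (a : Fin r → Fin n) : ℝ :=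
  ∑ p, ∑ q, (G y)⁻¹ p q * covDeriv G (covDeriv G T) y (Fin.cons p (Fin.cons q a))

/-! ### The flow on a manifold -/

variable {M : Type*} [TopologicalSpace M] [ChartedSpace (EuclideanSpace ℝ (Fin n)) M]
  [IsManifold (𝓡 n) ∞ M]

/-- Smooth Riemannian metrics on the `n`-manifold `M`. -/
abbrev SmoothMetric (n : ℕ) (M : Type*) [TopologicalSpace M]
    [ChartedSpace (EuclideanSpace ℝ (Fin n)) M] [IsManifold (𝓡 n) ∞ M] :=
  Bundle.ContMDiffRiemannianMetric (𝓡 n) ∞ (EuclideanSpace ℝ (Fin n))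
    (fun x : M => TangentSpace (𝓡 n) x)

/-- The coordinate vector field `∂_i` of the chart `φ` at the point with coordinates `y`. -/
def coordVec (φ : OpenPartialHomeomorph M (EuclideanSpace ℝ (Fin n)))
    (y : EuclideanSpace ℝ (Fin n)) (i : Fin n) : TangentSpace (𝓡 n) (φ.symm y) :=
  mfderiv (𝓡 n) (𝓡 n) φ.symm y (EuclideanSpace.single i (1 : ℝ) : EuclideanSpace ℝ (Fin n))

/-- The components `g_ij = g(∂_i, ∂_j)` of the metric `g` in the chart `φ`, as functions of the
coordinates (meaningful on `φ.target`). -/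
def metricCoord (g : SmoothMetric n M) (φ : OpenPartialHomeomorph M (EuclideanSpace ℝ (Fin n)))
    (y : EuclideanSpace ℝ (Fin n)) : Matrix (Fin n) (Fin n) ℝ :=
  fun i j => g.inner (φ.symm y) (coordVec φ y i) (coordVec φ y j)

/-- `g(t)`, for `t` in the time interval `J`, is a smooth solution on `M` of the Ricci–Bourguignon
flow `∂g/∂t = -2 Ric + 2 ρ R g` (only the values `g t` with `t ∈ J` matter; at an end point of `J`
the time derivative is one-sided). -/
structure IsRBFlow (ρ : ℝ) (J : Set ℝ) (g : ℝ → SmoothMetric n M) : Prop where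
  smooth : ∀ φ ∈ IsManifold.maximalAtlas (𝓡 n) ∞ M, ∀ i j : Fin n,
    ContDiffOn ℝ ∞ (fun q : ℝ × EuclideanSpace ℝ (Fin n) => metricCoord (g q.1) φ q.2 i j)
      (J ×ˢ φ.target)
  evolution : ∀ φ ∈ IsManifold.maximalAtlas (𝓡 n) ∞ M, ∀ t ∈ J, ∀ y ∈ φ.target, ∀ i j : Fin n,
    HasDerivWithinAt (fun s => metricCoord (g s) φ y i j)
      (-2 * ric (metricCoord (g t) φ) y i j
        + 2 * ρ * scal (metricCoord (g t) φ) y * metricCoord (g t) φ y i j) J t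

end RBFlow

end

/-! Everything is computed in one chart. Put u = 2ρR and h = ∂_t g = -2 Ric + u g. Since ∂_t
commutes with coordinate derivatives, the Christoffel symbols vary by the tensor ½ g^kl (∇_i h_jl +
∇_j h_il - ∇_l h_ij), and Riem varies by one copy of h contracted with Riem plus an antisymmetrised
combination of second covariant derivatives of h (`hasDerivWithinAt_riem`).

The metric is parallel, so ∇²h = -2 ∇²Ric + ∇²u ⊗ g. Hamilton's argument trades ∇²Ric for ΔRiem: two
uses of the second Bianchi identity, with a commutation of derivatives between them, express ΔRiem
by ∇²Ric and quadratic curvature terms (`IsSecondDerivative.ctr_eq`). Hence ∂_t Riem = ΔRiem + 2(B -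
B - B + B)(Riem) - Ric * Riem + u Riem - ½ ∇²u ⊙ g (`variation_eq`), where * is the action of Ric on
the four indices.

Tracing gives the evolution of Ric and R. In the combination defining W the term ∇²u ⊙ g cancels
against its traces, and ΔRiem with its traces assembles into ΔW because Δ commutes with contraction
and with ⊙ g (`laplacian_weylField`). It remains to rewrite B(Riem) and Ric * Riem through W = Riem
- A ⊙ g, with A = Ric/(n-2) - R g/(2(n-1)(n-2)) (`reaction_kulkarniNomizu`,
`ricAct_kulkarniNomizu`); the leftovers are the Ric², Ric ⊙ Ric, R and |Ric|² terms of the statement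
(`weyl_variation_eq`).

Two devices keep the computation short. The connection and the curvature are treated as
matrix-valued functions, so most differential identities become identities in a noncommutative ring.
Covariant derivatives are taken in a fixed direction (`nab2`, `nab4`), which keeps the order of the
tensor; the correction for the direction index enters only in `hess2` and `hess4`. Once the
symmetries of Riem and ∇²Riem are known, the rest is algebra at a point, for arrays with these
symmetries. -/

noncomputable section

namespace RBFlow

variable {n : ℕ}

/-! ### Partial derivatives -/

section PartialDerivatives

variable {U : Set (EuclideanSpace ℝ (Fin n))} {f g : EuclideanSpace ℝ (Fin n) → ℝ}
  {y : EuclideanSpace ℝ (Fin n)}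

theorem differentiableAt_of_contDiffOn (hU : IsOpen U) (hf : ContDiffOn ℝ ∞ f U)
    (hy : y ∈ U) : DifferentiableAt ℝ f y :=
  (hf.contDiffAt (hU.mem_nhds hy)).differentiableAt (by simp)

theorem pd_add (k : Fin n) (hf : DifferentiableAt ℝ f y) (hg : DifferentiableAt ℝ g y) :
    pd k (fun z => f z + g z) y = pd k f y + pd k g y := by
  simp [pd, fderiv_fun_add hf hg]

theorem pd_sub (k : Fin n) (hf : DifferentiableAt ℝ f y) (hg : DifferentiableAt ℝ g y) :
    pd k (fun z => f z - g z) y = pd k f y - pd k g y := by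
  simp [pd, fderiv_fun_sub hf hg]

theorem pd_mul (k : Fin n) (hf : DifferentiableAt ℝ f y) (hg : DifferentiableAt ℝ g y) :
    pd k (fun z => f z * g z) y = pd k f y * g y + f y * pd k g y := by
  simp [pd, fderiv_fun_mul hf hg]; ring

theorem pd_neg (k : Fin n) : pd k (fun z => -f z) y = -pd k f y := by
  simp [pd, fderiv_fun_neg]

theorem pd_const (k : Fin n) (c : ℝ) : pd k (fun _ => c) y = 0 := by
  simp [pd]

theorem pd_const_mul (k : Fin n) (c : ℝ) (hf : DifferentiableAt ℝ f y) :
    pd k (fun z => c * f z) y = c * pd k f y := by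
  simp [pd, fderiv_const_mul hf]

theorem pd_sum {ι : Type*} (s : Finset ι) (k : Fin n) {f : ι → EuclideanSpace ℝ (Fin n) → ℝ}
    (hf : ∀ i ∈ s, DifferentiableAt ℝ (f i) y) :
    pd k (fun z => ∑ i ∈ s, f i z) y = ∑ i ∈ s, pd k (f i) y := by
  simp [pd, fderiv_fun_sum hf]

theorem pd_congr (hU : IsOpen U) (hy : y ∈ U) (k : Fin n) (h : ∀ z ∈ U, f z = g z) :
    pd k f y = pd k g y := by
  have : f =ᶠ[nhds y] g := Filter.eventuallyEq_of_mem (hU.mem_nhds hy) h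
  simp [pd, this.fderiv_eq]

theorem contDiffOn_pd (hU : IsOpen U) (hf : ContDiffOn ℝ ∞ f U) (k : Fin n) :
    ContDiffOn ℝ ∞ (pd k f) U :=
  (hf.fderiv_of_isOpen hU (m := ∞) (by simp)).clm_apply contDiffOn_const

theorem pd_comm (hU : IsOpen U) (hf : ContDiffOn ℝ ∞ f U) (hy : y ∈ U) (i j : Fin n) :
    pd i (pd j f) y = pd j (pd i f) y := by
  have hc : ContDiffAt ℝ ∞ f y := hf.contDiffAt (hU.mem_nhds hy)
  have hs : IsSymmSndFDerivAt ℝ f y := hc.isSymmSndFDerivAt (by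
    simpa using (by exact_mod_cast le_top : ((2 : ℕ∞) : WithTop ℕ∞) ≤ ((⊤ : ℕ∞) : WithTop ℕ∞)))
  have hd : DifferentiableAt ℝ (fderiv ℝ f) y :=
    (hc.fderiv_right (m := ∞) (by simp)).differentiableAt (by simp)
  have key : ∀ a b : Fin n, pd a (pd b f) y
      = fderiv ℝ (fderiv ℝ f) y (EuclideanSpace.single a 1) (EuclideanSpace.single b 1) := by
    intro a b
    have : pd b f = fun z => fderiv ℝ f z (EuclideanSpace.single b 1) := rfl
    rw [pd, this, fderiv_clm_apply hd (differentiableAt_const _)]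
    simp
  rw [key, key, hs]

end PartialDerivatives

/-! ### Matrix-valued functions -/

section MatrixCalculus

open Matrix

/-- Entrywise partial derivative of a matrix-valued function. -/
def pdM (k : Fin n) (F : EuclideanSpace ℝ (Fin n) → Matrix (Fin n) (Fin n) ℝ)
    (y : EuclideanSpace ℝ (Fin n)) : Matrix (Fin n) (Fin n) ℝ :=
  fun i j => pd k (fun z => F z i j) y

/-- Entrywise smoothness of a matrix-valued function on `U`. -/
def SmoothMat (U : Set (EuclideanSpace ℝ (Fin n)))
    (F : EuclideanSpace ℝ (Fin n) → Matrix (Fin n) (Fin n) ℝ) : Prop :=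
  ∀ i j, ContDiffOn ℝ ∞ (fun z => F z i j) U

variable {U : Set (EuclideanSpace ℝ (Fin n))}
  {F H : EuclideanSpace ℝ (Fin n) → Matrix (Fin n) (Fin n) ℝ} {y : EuclideanSpace ℝ (Fin n)}

theorem SmoothMat.add (hF : SmoothMat U F) (hH : SmoothMat U H) :
    SmoothMat U (fun z => F z + H z) := fun i j => (hF i j).add (hH i j)

theorem SmoothMat.sub (hF : SmoothMat U F) (hH : SmoothMat U H) :
    SmoothMat U (fun z => F z - H z) := fun i j => (hF i j).sub (hH i j)

theorem SmoothMat.mul (hF : SmoothMat U F) (hH : SmoothMat U H) :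
    SmoothMat U (fun z => F z * H z) := by
  intro i j
  simp only [Matrix.mul_apply]
  exact ContDiffOn.sum fun m _ => (hF i m).mul (hH m j)

theorem SmoothMat.transpose (hF : SmoothMat U F) : SmoothMat U (fun z => (F z)ᵀ) :=
  fun i j => hF j i

theorem SmoothMat.pdM (hU : IsOpen U) (hF : SmoothMat U F) (k : Fin n) :
    SmoothMat U (pdM k F) := fun i j => contDiffOn_pd hU (hF i j) k

theorem SmoothMat.differentiableAt (hU : IsOpen U) (hF : SmoothMat U F) (hy : y ∈ U)
    (i j : Fin n) : DifferentiableAt ℝ (fun z => F z i j) y :=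
  differentiableAt_of_contDiffOn hU (hF i j) hy

theorem pdM_add (hU : IsOpen U) (hF : SmoothMat U F) (hH : SmoothMat U H) (hy : y ∈ U)
    (k : Fin n) : pdM k (fun z => F z + H z) y = pdM k F y + pdM k H y := by
  ext i j
  exact pd_add k (hF.differentiableAt hU hy i j) (hH.differentiableAt hU hy i j)

theorem pdM_sub (hU : IsOpen U) (hF : SmoothMat U F) (hH : SmoothMat U H) (hy : y ∈ U)
    (k : Fin n) : pdM k (fun z => F z - H z) y = pdM k F y - pdM k H y := by
  ext i j
  exact pd_sub k (hF.differentiableAt hU hy i j) (hH.differentiableAt hU hy i j)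

theorem pdM_mul (hU : IsOpen U) (hF : SmoothMat U F) (hH : SmoothMat U H) (hy : y ∈ U)
    (k : Fin n) : pdM k (fun z => F z * H z) y = pdM k F y * H y + F y * pdM k H y := by
  ext i j
  simp only [pdM, Matrix.mul_apply, Matrix.add_apply]
  rw [pd_sum (f := fun m z => F z i m * H z m j) _ _ fun m _ =>
      (hF.differentiableAt hU hy i m).fun_mul (hH.differentiableAt hU hy m j),
    ← Finset.sum_add_distrib]
  exact Finset.sum_congr rfl fun m _ =>
    pd_mul k (hF.differentiableAt hU hy i m) (hH.differentiableAt hU hy m j)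

theorem pdM_transpose (k : Fin n) : pdM k (fun z => (F z)ᵀ) y = (pdM k F y)ᵀ := rfl

theorem pdM_congr (hU : IsOpen U) (hy : y ∈ U) (k : Fin n) (h : ∀ z ∈ U, F z = H z) :
    pdM k F y = pdM k H y := by
  ext i j
  exact pd_congr hU hy k fun z hz => by rw [h z hz]

theorem pdM_comm (hU : IsOpen U) (hF : SmoothMat U F) (hy : y ∈ U) (i j : Fin n) :
    pdM i (pdM j F) y = pdM j (pdM i F) y := by
  ext a b
  exact pd_comm hU (hF a b) hy i j

end MatrixCalculus

/-! ### Smoothness of the inverse matrix -/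

section Inverse

variable {X : Type*} [NormedAddCommGroup X] [NormedSpace ℝ X] {s : Set X}
  {A : X → Matrix (Fin n) (Fin n) ℝ}

theorem contDiffOn_det (hA : ∀ i j, ContDiffOn ℝ ∞ (fun x => A x i j) s) :
    ContDiffOn ℝ ∞ (fun x => (A x).det) s := by
  simp only [Matrix.det_apply']
  exact ContDiffOn.sum fun σ _ => contDiffOn_const.mul (contDiffOn_prod fun i _ => hA _ _)

/-- Cramer's rule: an entry of the inverse is the inverse of the determinant times an adjugate
entry, which is the determinant of the matrix with one row replaced by a constant basis vector. -/
theorem contDiffOn_matrix_inv (hA : ∀ i j, ContDiffOn ℝ ∞ (fun x => A x i j) s)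
    (hdet : ∀ x ∈ s, IsUnit (A x).det) (i j : Fin n) :
    ContDiffOn ℝ ∞ (fun x => (A x)⁻¹ i j) s := by
  simp only [Matrix.inv_def, Ring.inverse_eq_inv', Matrix.smul_apply, smul_eq_mul,
    Matrix.adjugate_apply]
  refine ((contDiffOn_det hA).inv fun x hx => (hdet x hx).ne_zero).mul (contDiffOn_det ?_)
  intro a b
  by_cases h : a = j
  · subst h
    simpa using contDiffOn_const
  · simpa [Matrix.updateRow_ne h] using hA a b

end Inverse

/-! ### Levi-Civita connection and curvature in a coordinate domain -/

/-- `G` is a smooth field of symmetric invertible matrices on the open set `U`. -/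
structure IsMetricOn (G : EuclideanSpace ℝ (Fin n) → Matrix (Fin n) (Fin n) ℝ)
    (U : Set (EuclideanSpace ℝ (Fin n))) : Prop where
  isOpen : IsOpen U
  smooth : SmoothMat U G
  symm : ∀ y ∈ U, (G y).transpose = G y
  det : ∀ y ∈ U, IsUnit (G y).det

/-- The connection matrix `(Γ_c)^k_j`. -/
def gam (G : EuclideanSpace ℝ (Fin n) → Matrix (Fin n) (Fin n) ℝ) (c : Fin n)
    (y : EuclideanSpace ℝ (Fin n)) : Matrix (Fin n) (Fin n) ℝ :=
  fun k j => christoffel G k c j y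

/-- The curvature matrix `(F_ij)^l_k = R^l_ijk`. -/
def curv (G : EuclideanSpace ℝ (Fin n) → Matrix (Fin n) (Fin n) ℝ) (i j : Fin n)
    (y : EuclideanSpace ℝ (Fin n)) : Matrix (Fin n) (Fin n) ℝ :=
  fun l k => riemUp G y l i j k

namespace IsMetricOn

open Matrix

variable {G : EuclideanSpace ℝ (Fin n) → Matrix (Fin n) (Fin n) ℝ}
  {U : Set (EuclideanSpace ℝ (Fin n))} {y : EuclideanSpace ℝ (Fin n)}

theorem apply_comm (hG : IsMetricOn G U) (hy : y ∈ U) (i j : Fin n) : G y i j = G y j i :=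
  congrFun (congrFun (hG.symm y hy) j) i

theorem mul_inv (hG : IsMetricOn G U) (hy : y ∈ U) : G y * (G y)⁻¹ = 1 :=
  Matrix.mul_nonsing_inv _ (hG.det y hy)

theorem inv_mul (hG : IsMetricOn G U) (hy : y ∈ U) : (G y)⁻¹ * G y = 1 :=
  Matrix.nonsing_inv_mul _ (hG.det y hy)

theorem inv_symm (hG : IsMetricOn G U) (hy : y ∈ U) : ((G y)⁻¹)ᵀ = (G y)⁻¹ := by
  rw [Matrix.transpose_nonsing_inv, hG.symm y hy]

theorem smooth_inv (hG : IsMetricOn G U) : SmoothMat U (fun z => (G z)⁻¹) :=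
  fun i j => contDiffOn_matrix_inv hG.smooth hG.det i j

theorem pd_symm (hG : IsMetricOn G U) (hy : y ∈ U) (k i j : Fin n) :
    pd k (fun z => G z i j) y = pd k (fun z => G z j i) y :=
  pd_congr hG.isOpen hy k fun _ hz => hG.apply_comm hz i j

theorem contDiffOn_christoffel (hG : IsMetricOn G U) (k i j : Fin n) :
    ContDiffOn ℝ ∞ (christoffel G k i j) U := by
  have hp : ∀ c a b, ContDiffOn ℝ ∞ (pd c (fun z => G z a b)) U :=
    fun c a b => contDiffOn_pd hG.isOpen (hG.smooth a b) c
  exact contDiffOn_const.mul (ContDiffOn.sum fun l _ =>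
    (hG.smooth_inv k l).mul (((hp i j l).add (hp j i l)).sub (hp l i j)))

theorem smooth_gam (hG : IsMetricOn G U) (c : Fin n) : SmoothMat U (gam G c) :=
  fun k j => hG.contDiffOn_christoffel k c j

theorem christoffel_comm (hG : IsMetricOn G U) (hy : y ∈ U) (k i j : Fin n) :
    christoffel G k i j y = christoffel G k j i y := by
  simp only [christoffel]
  congr 1
  refine Finset.sum_congr rfl fun l _ => ?_
  rw [hG.pd_symm hy l i j]
  ring

/-- Lowering the upper index cancels the inverse metric and leaves the Koszul expression, in which
no inverse occurs. -/
theorem sum_mul_christoffel (hG : IsMetricOn G U) (hy : y ∈ U) (m i j : Fin n) :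
    ∑ k, G y m k * christoffel G k i j y = (1 / 2) *
      (pd i (fun z => G z j m) y + pd j (fun z => G z i m) y - pd m (fun z => G z i j) y) := by
  set v : Fin n → ℝ := fun l =>
    pd i (fun z => G z j l) y + pd j (fun z => G z i l) y - pd l (fun z => G z i j) y with hv
  have h1 : G y *ᵥ ((G y)⁻¹ *ᵥ v) = v := by
    rw [Matrix.mulVec_mulVec, hG.mul_inv hy, Matrix.one_mulVec]
  have h2 := congrFun h1 m
  simp only [Matrix.mulVec, dotProduct] at h2
  rw [show pd i (fun z => G z j m) y + pd j (fun z => G z i m) y - pd m (fun z => G z i j) y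
    = v m from rfl, ← h2, Finset.mul_sum]
  refine Finset.sum_congr rfl fun k _ => ?_
  simp only [christoffel, hv]
  ring

/-- The metric is parallel. -/
theorem pdM_metric (hG : IsMetricOn G U) (hy : y ∈ U) (c : Fin n) :
    pdM c G y = (gam G c y)ᵀ * G y + G y * gam G c y := by
  ext i j
  have h1 := hG.sum_mul_christoffel hy j c i
  have h2 := hG.sum_mul_christoffel hy i c j
  simp only [Matrix.add_apply, Matrix.mul_apply, Matrix.transpose_apply, gam]
  rw [h2, Finset.sum_congr rfl fun m _ => show christoffel G m c i y * G y m j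
    = G y j m * christoffel G m c i y by rw [hG.apply_comm hy m j, mul_comm], h1, pdM,
    hG.pd_symm hy c j i]
  ring

/-- The inverse metric is parallel too: differentiate G⁻¹G = 1 and insert `pdM_metric`. -/
theorem pdM_inv (hG : IsMetricOn G U) (hy : y ∈ U) (c : Fin n) :
    pdM c (fun z => (G z)⁻¹) y = -(gam G c y * (G y)⁻¹) - (G y)⁻¹ * (gam G c y)ᵀ := by
  have h1 : pdM c (fun z => (G z)⁻¹ * G z) y = 0 := by
    rw [pdM_congr hG.isOpen hy c (H := fun _ => 1) fun z hz => hG.inv_mul hz]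
    ext i j
    exact pd_const c _
  rw [pdM_mul hG.isOpen hG.smooth_inv hG.smooth hy, hG.pdM_metric hy] at h1
  have h2 : (pdM c (fun z => (G z)⁻¹) y * G y) * (G y)⁻¹
      = -((G y)⁻¹ * ((gam G c y)ᵀ * G y + G y * gam G c y)) * (G y)⁻¹ := by
    rw [eq_neg_of_add_eq_zero_left h1]
  rw [mul_assoc, hG.mul_inv hy, mul_one] at h2
  rw [h2]
  have e1 : (G y)⁻¹ * ((gam G c y)ᵀ * G y + G y * gam G c y) * (G y)⁻¹
      = (G y)⁻¹ * (gam G c y)ᵀ * (G y * (G y)⁻¹)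
        + ((G y)⁻¹ * G y) * gam G c y * (G y)⁻¹ := by noncomm_ring
  rw [neg_mul, e1, hG.mul_inv hy, hG.inv_mul hy]
  noncomm_ring

/-- The form of a curvature F = dΓ + Γ∧Γ, up to sign; it lets `noncomm_ring` prove the later
curvature identities. -/
theorem curv_eq (i j : Fin n) (y : EuclideanSpace ℝ (Fin n)) :
    curv G i j y = pdM j (gam G i) y - pdM i (gam G j) y
      + gam G j y * gam G i y - gam G i y * gam G j y := by
  ext l k
  simp only [curv, riemUp, pdM, gam, Matrix.add_apply, Matrix.sub_apply, Matrix.mul_apply]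
  rw [Finset.sum_sub_distrib, add_sub_assoc]
  congr 2 <;> exact Finset.sum_congr rfl fun m _ => mul_comm _ _

theorem smooth_curv (hG : IsMetricOn G U) (i j : Fin n) : SmoothMat U (curv G i j) := by
  have h : curv G i j = fun y => pdM j (gam G i) y - pdM i (gam G j) y
      + gam G j y * gam G i y - gam G i y * gam G j y := funext fun y => curv_eq i j y
  rw [h]
  have hg := hG.smooth_gam
  exact ((((hg i).pdM hG.isOpen j).sub ((hg j).pdM hG.isOpen i)).add ((hg j).mul (hg i))).sub
    ((hg i).mul (hg j))

theorem riem_eq (y : EuclideanSpace ℝ (Fin n)) (i j k l : Fin n) :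
    riem G y i j k l = (G y * curv G i j y) l k := rfl

theorem riem_eq_transpose (hG : IsMetricOn G U) (hy : y ∈ U) (i j : Fin n) :
    riem G y i j = (curv G i j y)ᵀ * G y := by
  ext k l
  rw [riem_eq, ← Matrix.transpose_apply (G y * _), Matrix.transpose_mul, hG.symm y hy]

theorem curv_antisymm (i j : Fin n) (y : EuclideanSpace ℝ (Fin n)) :
    curv G i j y = -curv G j i y := by
  rw [curv_eq, curv_eq]; abel

/-- Differentiate ∂G = ΓᵀG + GΓ once more and use that the second partial derivatives of G commute.
What remains says that the curvature is skew for the metric, which is the antisymmetry of R_ijkl in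
k, l. -/
theorem curv_metric (hG : IsMetricOn G U) (hy : y ∈ U) (i j : Fin n) :
    (curv G i j y)ᵀ * G y + G y * curv G i j y = 0 := by
  have hg := hG.smooth_gam
  have key : ∀ p q, pdM p (pdM q G) y
      = (pdM p (gam G q) y)ᵀ * G y + (gam G q y)ᵀ * ((gam G p y)ᵀ * G y + G y * gam G p y)
        + (((gam G p y)ᵀ * G y + G y * gam G p y) * gam G q y + G y * pdM p (gam G q) y) := by
    intro p q
    rw [pdM_congr hG.isOpen hy p fun z hz => hG.pdM_metric hz q,
      pdM_add hG.isOpen ((hg q).transpose.mul hG.smooth) (hG.smooth.mul (hg q)) hy,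
      pdM_mul hG.isOpen (hg q).transpose hG.smooth hy, pdM_mul hG.isOpen hG.smooth (hg q) hy,
      hG.pdM_metric hy, pdM_transpose]
  have h := pdM_comm hG.isOpen hG.smooth hy i j
  rw [key, key, ← sub_eq_zero] at h
  rw [curv_eq, ← neg_eq_zero, ← h]
  simp only [Matrix.transpose_add, Matrix.transpose_sub, Matrix.transpose_mul]
  noncomm_ring

theorem riem_antisymm_left (y : EuclideanSpace ℝ (Fin n)) (i j k l : Fin n) :
    riem G y i j k l = -riem G y j i k l := by
  rw [riem_eq, riem_eq, curv_antisymm i j]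
  simp

theorem riem_antisymm_right (hG : IsMetricOn G U) (hy : y ∈ U) (i j k l : Fin n) :
    riem G y i j k l = -riem G y i j l k := by
  have h := congrFun (congrFun (hG.curv_metric hy i j) k) l
  have h' : riem G y i j k l = ((curv G i j y)ᵀ * G y) k l :=
    congrFun (congrFun (hG.riem_eq_transpose hy i j) k) l
  rw [Matrix.add_apply, ← h', ← riem_eq] at h
  exact eq_neg_of_add_eq_zero_left h

/-- Torsion-freeness alone: by the symmetry of the Christoffel symbols the derivative terms and the
quadratic terms cancel already for R^m_ijk, before the index is lowered. -/
theorem riem_bianchi (hG : IsMetricOn G U) (hy : y ∈ U) (i j k l : Fin n) :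
    riem G y i j k l + riem G y j k i l + riem G y k i j l = 0 := by
  have hc := hG.christoffel_comm hy
  have hp : ∀ c m a b, pd c (christoffel G m a b) y = pd c (christoffel G m b a) y :=
    fun c m a b => pd_congr hG.isOpen hy c fun z hz => hG.christoffel_comm hz m a b
  simp only [riem]
  rw [← Finset.sum_add_distrib, ← Finset.sum_add_distrib]
  refine Finset.sum_eq_zero fun m _ => ?_
  rw [← mul_add, ← mul_add]
  refine mul_eq_zero_of_right _ ?_
  simp only [riemUp, Finset.sum_sub_distrib]
  rw [hp j m k i, hp k m j i, hp i m k j]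
  simp only [hc _ k i, hc _ j i, hc _ k j]
  ring

/-- The classical combination of four first Bianchi identities, one for each cyclic shift of i, j,
k, l, with the two antisymmetries. -/
theorem riem_pair_symm (hG : IsMetricOn G U) (hy : y ∈ U) (i j k l : Fin n) :
    riem G y i j k l = riem G y k l i j := by
  have a1 := riem_antisymm_left (G := G) y
  have a2 := hG.riem_antisymm_right hy
  have b := hG.riem_bianchi hy
  linarith [b i j k l, b j k l i, b k l i j, b l i j k, a1 i j k l, a1 j k i l, a1 k i j l,
    a2 i j k l, a2 j k l i, a2 k l j i, a2 l j k i, a1 l i j k, a2 l i j k, a2 i j l k,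
    a2 j l i k, a1 j l i k, a1 k l i j, a2 k l i j, a1 l i k j, a2 l i k j, a2 i k l j, a1 i k l j,
    a2 j k i l, a1 k i l j, a2 k i j l, a1 i j l k, a1 l j k i, a1 k l j i, a1 j k l i]

end IsMetricOn

/-! ### Covariant derivatives in a fixed coordinate direction -/

/-- The derivation of tensors with four lower indices induced by the matrix `A`. -/
def act4 (A : Matrix (Fin n) (Fin n) ℝ) (X : Fin n → Fin n → Fin n → Fin n → ℝ)
    (i j k l : Fin n) : ℝ :=
  ∑ m, (A m i * X m j k l + A m j * X i m k l + A m k * X i j m l + A m l * X i j k m)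

/-- `∇_c T_ij`, as a tensor with two indices for each fixed `c`. -/
def nab2 (G : EuclideanSpace ℝ (Fin n) → Matrix (Fin n) (Fin n) ℝ) (c : Fin n)
    (T : EuclideanSpace ℝ (Fin n) → Matrix (Fin n) (Fin n) ℝ)
    (y : EuclideanSpace ℝ (Fin n)) : Matrix (Fin n) (Fin n) ℝ :=
  fun i j => pd c (fun z => T z i j) y
    - ∑ m, (christoffel G m c i y * T y m j + christoffel G m c j y * T y i m)

/-- `∇_c T_ijkl`, as a tensor with four indices for each fixed `c`. -/
def nab4 (G : EuclideanSpace ℝ (Fin n) → Matrix (Fin n) (Fin n) ℝ) (c : Fin n)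
    (T : EuclideanSpace ℝ (Fin n) → Fin n → Fin n → Fin n → Fin n → ℝ)
    (y : EuclideanSpace ℝ (Fin n)) (i j k l : Fin n) : ℝ :=
  pd c (fun z => T z i j k l) y - act4 (gam G c y) (T y) i j k l

/-- `∇_p ∇_q f` for a function `f`. -/
def hess0 (G : EuclideanSpace ℝ (Fin n) → Matrix (Fin n) (Fin n) ℝ)
    (f : EuclideanSpace ℝ (Fin n) → ℝ) (y : EuclideanSpace ℝ (Fin n)) (p q : Fin n) : ℝ :=
  pd p (pd q f) y - ∑ m, christoffel G m p q y * pd m f y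

/-- `∇_p ∇_q T_ij`. -/
def hess2 (G : EuclideanSpace ℝ (Fin n) → Matrix (Fin n) (Fin n) ℝ)
    (T : EuclideanSpace ℝ (Fin n) → Matrix (Fin n) (Fin n) ℝ)
    (y : EuclideanSpace ℝ (Fin n)) (p q : Fin n) : Matrix (Fin n) (Fin n) ℝ :=
  fun i j => nab2 G p (nab2 G q T) y i j - ∑ m, christoffel G m p q y * nab2 G m T y i j

/-- `∇_p ∇_q T_ijkl`. -/
def hess4 (G : EuclideanSpace ℝ (Fin n) → Matrix (Fin n) (Fin n) ℝ)
    (T : EuclideanSpace ℝ (Fin n) → Fin n → Fin n → Fin n → Fin n → ℝ)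
    (y : EuclideanSpace ℝ (Fin n)) (p q i j k l : Fin n) : ℝ :=
  nab4 G p (nab4 G q T) y i j k l - ∑ m, christoffel G m p q y * nab4 G m T y i j k l

/-- Smoothness on `U` of the components of a tensor with four indices. -/
def SmoothTensor (U : Set (EuclideanSpace ℝ (Fin n)))
    (T : EuclideanSpace ℝ (Fin n) → Fin n → Fin n → Fin n → Fin n → ℝ) : Prop :=
  ∀ i j k l, ContDiffOn ℝ ∞ (fun z => T z i j k l) U

theorem act4_add (A B : Matrix (Fin n) (Fin n) ℝ) (X : Fin n → Fin n → Fin n → Fin n → ℝ)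
    (i j k l : Fin n) : act4 (A + B) X i j k l = act4 A X i j k l + act4 B X i j k l := by
  simp only [act4, Matrix.add_apply, ← Finset.sum_add_distrib]
  exact Finset.sum_congr rfl fun m _ => by ring

theorem act4_sub (A B : Matrix (Fin n) (Fin n) ℝ) (X : Fin n → Fin n → Fin n → Fin n → ℝ)
    (i j k l : Fin n) : act4 (A - B) X i j k l = act4 A X i j k l - act4 B X i j k l := by
  simp only [act4, Matrix.sub_apply, ← Finset.sum_sub_distrib]
  exact Finset.sum_congr rfl fun m _ => by ring

theorem act4_sub_right (A : Matrix (Fin n) (Fin n) ℝ) (X Y : Fin n → Fin n → Fin n → Fin n → ℝ)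
    (i j k l : Fin n) : act4 A (fun a b c d => X a b c d - Y a b c d) i j k l
      = act4 A X i j k l - act4 A Y i j k l := by
  simp only [act4, ← Finset.sum_sub_distrib]
  exact Finset.sum_congr rfl fun m _ => by ring

/-- Actions on different slots commute (`cross`), so only the terms hitting one slot twice survive
(`diag`). The order of the product is reversed because lower indices carry the dual action. -/
theorem act4_commutator (A B : Matrix (Fin n) (Fin n) ℝ)
    (X : Fin n → Fin n → Fin n → Fin n → ℝ) (i j k l : Fin n) :
    act4 A (act4 B X) i j k l - act4 B (act4 A X) i j k l = act4 (B * A - A * B) X i j k l := by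
  have cross : ∀ (a b : Fin n) (Y : Fin n → Fin n → ℝ),
      ∑ m, A m a * ∑ m', B m' b * Y m m' = ∑ m', B m' b * ∑ m, A m a * Y m m' := by
    intro a b Y
    simp only [Finset.mul_sum]
    rw [Finset.sum_comm]
    exact Finset.sum_congr rfl fun _ _ => Finset.sum_congr rfl fun _ _ => by ring
  have diag : ∀ (A B : Matrix (Fin n) (Fin n) ℝ) (a : Fin n) (Y : Fin n → ℝ),
      ∑ m, A m a * ∑ m', B m' m * Y m' = ∑ m', (B * A) m' a * Y m' := by
    intro A B a Y
    simp only [Finset.mul_sum, Matrix.mul_apply, Finset.sum_mul]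
    rw [Finset.sum_comm]
    exact Finset.sum_congr rfl fun _ _ => Finset.sum_congr rfl fun _ _ => by ring
  rw [act4_sub]
  simp only [act4, Finset.sum_add_distrib, mul_add, diag]
  rw [cross i j fun m m' => X m m' k l, cross i k fun m m' => X m j m' l,
    cross i l fun m m' => X m j k m', cross j i fun m m' => X m' m k l,
    cross j k fun m m' => X i m m' l, cross j l fun m m' => X i m k m',
    cross k i fun m m' => X m' j m l, cross k j fun m m' => X i m' m l,
    cross k l fun m m' => X i j m m', cross l i fun m m' => X m' j k m,
    cross l j fun m m' => X i m' k m, cross l k fun m m' => X i j m' m]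
  ring

theorem nab2_eq (G : EuclideanSpace ℝ (Fin n) → Matrix (Fin n) (Fin n) ℝ) (c : Fin n)
    (T : EuclideanSpace ℝ (Fin n) → Matrix (Fin n) (Fin n) ℝ) (y : EuclideanSpace ℝ (Fin n)) :
    nab2 G c T y = pdM c T y - (gam G c y).transpose * T y - T y * gam G c y := by
  ext i j
  simp only [nab2, pdM, gam, Matrix.sub_apply, Matrix.mul_apply, Matrix.transpose_apply,
    Finset.sum_add_distrib]
  rw [← sub_sub]
  congr 1
  exact Finset.sum_congr rfl fun m _ => mul_comm _ _

namespace IsMetricOn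

open Matrix

variable {G : EuclideanSpace ℝ (Fin n) → Matrix (Fin n) (Fin n) ℝ}
  {U : Set (EuclideanSpace ℝ (Fin n))} {y : EuclideanSpace ℝ (Fin n)}
  {S : EuclideanSpace ℝ (Fin n) → Matrix (Fin n) (Fin n) ℝ}
  {T : EuclideanSpace ℝ (Fin n) → Fin n → Fin n → Fin n → Fin n → ℝ}

theorem smooth_nab2 (hG : IsMetricOn G U) (hS : SmoothMat U S) (c : Fin n) :
    SmoothMat U (nab2 G c S) := by
  have h : nab2 G c S = fun y => pdM c S y - (gam G c y)ᵀ * S y - S y * gam G c y :=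
    funext fun y => nab2_eq G c S y
  rw [h]
  exact ((hS.pdM hG.isOpen c).sub ((hG.smooth_gam c).transpose.mul hS)).sub
    (hS.mul (hG.smooth_gam c))

theorem smooth_act4 {A : EuclideanSpace ℝ (Fin n) → Matrix (Fin n) (Fin n) ℝ}
    (hA : SmoothMat U A) (hT : SmoothTensor U T) :
    SmoothTensor U (fun z => act4 (A z) (T z)) := by
  intro i j k l
  exact ContDiffOn.sum fun m _ => ((((hA m i).mul (hT m j k l)).add ((hA m j).mul (hT i m k l))).add
    ((hA m k).mul (hT i j m l))).add ((hA m l).mul (hT i j k m))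

theorem smooth_nab4 (hG : IsMetricOn G U) (hT : SmoothTensor U T) (c : Fin n) :
    SmoothTensor U (nab4 G c T) := fun i j k l =>
  (contDiffOn_pd hG.isOpen (hT i j k l) c).sub (smooth_act4 (hG.smooth_gam c) hT i j k l)

theorem pd_act4 (hU : IsOpen U) (hy : y ∈ U)
    {A : EuclideanSpace ℝ (Fin n) → Matrix (Fin n) (Fin n) ℝ}
    (hA : SmoothMat U A) (hT : SmoothTensor U T) (p i j k l : Fin n) :
    pd p (fun z => act4 (A z) (T z) i j k l) y
      = act4 (pdM p A y) (T y) i j k l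
        + act4 (A y) (fun a b c d => pd p (fun z => T z a b c d) y) i j k l := by
  have dA := fun a b => hA.differentiableAt hU hy a b
  have dT := fun a b c d => differentiableAt_of_contDiffOn hU (hT a b c d) hy
  simp only [act4]
  rw [pd_sum, ← Finset.sum_add_distrib]
  · refine Finset.sum_congr rfl fun m _ => ?_
    rw [pd_add, pd_add, pd_add, pd_mul _ (dA _ _) (dT _ _ _ _), pd_mul _ (dA _ _) (dT _ _ _ _),
      pd_mul _ (dA _ _) (dT _ _ _ _), pd_mul _ (dA _ _) (dT _ _ _ _)]
    · simp only [pdM]; ring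
    all_goals fun_prop (disch := first | exact dA _ _ | exact dT _ _ _ _)
  · intro m _
    fun_prop (disch := first | exact dA _ _ | exact dT _ _ _ _)

/-- The Ricci identity. -/
theorem nab4_commutator (hG : IsMetricOn G U) (hy : y ∈ U) (hT : SmoothTensor U T)
    (p q i j k l : Fin n) :
    nab4 G p (nab4 G q T) y i j k l - nab4 G q (nab4 G p T) y i j k l
      = act4 (curv G p q y) (T y) i j k l := by
  have key : ∀ p q, nab4 G p (nab4 G q T) y i j k l
      = pd p (pd q fun z => T z i j k l) y - act4 (pdM p (gam G q) y) (T y) i j k l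
        - act4 (gam G q y) (fun a b c d => pd p (fun z => T z a b c d) y) i j k l
        - act4 (gam G p y) (fun a b c d => pd q (fun z => T z a b c d) y) i j k l
        + act4 (gam G p y) (act4 (gam G q y) (T y)) i j k l := by
    intro p q
    have d1 := differentiableAt_of_contDiffOn hG.isOpen
      (contDiffOn_pd hG.isOpen (hT i j k l) q) hy
    have d2 := differentiableAt_of_contDiffOn hG.isOpen
      (smooth_act4 (hG.smooth_gam q) hT i j k l) hy
    have e1 : pd p (fun z => nab4 G q T z i j k l) y
        = pd p (pd q fun z => T z i j k l) y
          - pd p (fun z => act4 (gam G q z) (T z) i j k l) y := pd_sub p d1 d2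
    have e2 : act4 (gam G p y) (nab4 G q T y) i j k l
        = act4 (gam G p y) (fun a b c d => pd q (fun z => T z a b c d) y) i j k l
          - act4 (gam G p y) (act4 (gam G q y) (T y)) i j k l :=
      act4_sub_right _ (fun a b c d => pd q (fun z => T z a b c d) y)
        (act4 (gam G q y) (T y)) i j k l
    rw [nab4, e1, e2, pd_act4 hG.isOpen hy (hG.smooth_gam q) hT]
    ring
  have hc := pd_comm hG.isOpen (hT i j k l) hy p q
  have ha := act4_commutator (gam G p y) (gam G q y) (T y) i j k l
  rw [act4_sub] at ha
  rw [key, key, curv_eq, act4_sub, act4_add, act4_sub]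
  linear_combination hc + ha

theorem hess4_commutator (hG : IsMetricOn G U) (hy : y ∈ U) (hT : SmoothTensor U T)
    (p q i j k l : Fin n) :
    hess4 G T y p q i j k l - hess4 G T y q p i j k l = act4 (curv G p q y) (T y) i j k l := by
  rw [← hG.nab4_commutator hy hT, hess4, hess4]
  simp only [hG.christoffel_comm hy _ q p]
  ring

/-- Lowering an index commutes with covariant differentiation, the metric being parallel; an
endomorphism field S is differentiated through the commutator with Γ. -/
theorem pdM_transpose_mul_metric (hG : IsMetricOn G U) (hy : y ∈ U) (hS : SmoothMat U S)
    (c : Fin n) :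
    pdM c (fun z => (S z)ᵀ * G z) y - (gam G c y)ᵀ * ((S y)ᵀ * G y) - ((S y)ᵀ * G y) * gam G c y
      = (pdM c S y + gam G c y * S y - S y * gam G c y)ᵀ * G y := by
  rw [pdM_mul hG.isOpen hS.transpose hG.smooth hy, hG.pdM_metric hy, pdM_transpose]
  simp only [Matrix.transpose_add, Matrix.transpose_sub, Matrix.transpose_mul]
  noncomm_ring

/-- The Bianchi identity of an arbitrary matrix connection: only the commutation of partial
derivatives enters, and i, j, q are mere labels. Symmetry of Γ is not needed at this stage. -/
theorem curv_bianchi (hG : IsMetricOn G U) (hy : y ∈ U) (q i j : Fin n) :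
    (pdM q (curv G i j) y + gam G q y * curv G i j y - curv G i j y * gam G q y)
    + (pdM i (curv G j q) y + gam G i y * curv G j q y - curv G j q y * gam G i y)
    + (pdM j (curv G q i) y + gam G j y * curv G q i y - curv G q i y * gam G j y) = 0 := by
  have hg := hG.smooth_gam
  have hd := fun a b => (hg a).pdM hG.isOpen b
  have key : ∀ q i j, pdM q (curv G i j) y
      = pdM q (pdM j (gam G i)) y - pdM q (pdM i (gam G j)) y
        + (pdM q (gam G j) y * gam G i y + gam G j y * pdM q (gam G i) y)
        - (pdM q (gam G i) y * gam G j y + gam G i y * pdM q (gam G j) y) := by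
    intro q i j
    have h : curv G i j = fun y => pdM j (gam G i) y - pdM i (gam G j) y
      + gam G j y * gam G i y - gam G i y * gam G j y := funext fun y => curv_eq i j y
    rw [h, pdM_sub hG.isOpen (((hd i j).sub (hd j i)).add ((hg j).mul (hg i)))
      ((hg i).mul (hg j)) hy, pdM_add hG.isOpen ((hd i j).sub (hd j i)) ((hg j).mul (hg i)) hy,
      pdM_sub hG.isOpen (hd i j) (hd j i) hy, pdM_mul hG.isOpen (hg j) (hg i) hy,
      pdM_mul hG.isOpen (hg i) (hg j) hy]
  rw [key, key, key, curv_eq, curv_eq, curv_eq, pdM_comm hG.isOpen (hg i) hy q j,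
    pdM_comm hG.isOpen (hg j) hy q i, pdM_comm hG.isOpen (hg q) hy i j]
  noncomm_ring

theorem smooth_riem (hG : IsMetricOn G U) : SmoothTensor U (riem G) := fun i j k l =>
  (hG.smooth.mul (hG.smooth_curv i j)) l k

/-- Separates the endomorphism indices k, l, on which the connection acts by a commutator, from the
form indices i, j, whose Christoffel terms are listed apart. -/
theorem nab4_riem (hG : IsMetricOn G U) (hy : y ∈ U) (c i j k l : Fin n) :
    nab4 G c (riem G) y i j k l
      = ((pdM c (curv G i j) y + gam G c y * curv G i j y - curv G i j y * gam G c y)ᵀ * G y) k l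
        - ∑ m, (christoffel G m c i y * riem G y m j k l
          + christoffel G m c j y * riem G y i m k l) := by
  rw [← hG.pdM_transpose_mul_metric hy (hG.smooth_curv i j)]
  have e : ∀ z ∈ U, ∀ i j k l, ((curv G i j z)ᵀ * G z) k l = riem G z i j k l := fun z hz i j k l =>
    (congrFun (congrFun (hG.riem_eq_transpose hz i j) k) l).symm
  simp only [nab4, act4, Finset.sum_add_distrib, Matrix.sub_apply,
    Matrix.mul_apply (M := (gam G c y)ᵀ), Matrix.mul_apply (N := gam G c y), e y hy,
    Matrix.transpose_apply, gam, pdM]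
  rw [pd_congr hG.isOpen hy c fun z hz => e z hz i j k l]
  simp only [mul_comm (riem G y i j k _)]
  ring

/-- The second Bianchi identity. -/
theorem nab4_riem_bianchi (hG : IsMetricOn G U) (hy : y ∈ U) (q i j k l : Fin n) :
    nab4 G q (riem G) y i j k l + nab4 G i (riem G) y j q k l + nab4 G j (riem G) y q i k l
      = 0 := by
  have h := hG.curv_bianchi hy q i j
  have h2 := congrArg (fun M : Matrix (Fin n) (Fin n) ℝ => (Mᵀ * G y) k l) h
  simp only [Matrix.transpose_add, Matrix.add_mul, Matrix.add_apply, Matrix.transpose_zero,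
    Matrix.zero_mul, Matrix.zero_apply] at h2
  rw [hG.nab4_riem hy, hG.nab4_riem hy, hG.nab4_riem hy]
  -- The Christoffel terms of the form indices cancel in the cyclic sum, by symmetry of Γ and
  -- antisymmetry of Riem in its first pair.
  have h3 : ∑ m, (christoffel G m q i y * riem G y m j k l
          + christoffel G m q j y * riem G y i m k l)
      + ∑ m, (christoffel G m i j y * riem G y m q k l
          + christoffel G m i q y * riem G y j m k l)
      + ∑ m, (christoffel G m j q y * riem G y m i k l
          + christoffel G m j i y * riem G y q m k l) = 0 := by
    rw [← Finset.sum_add_distrib, ← Finset.sum_add_distrib]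
    refine Finset.sum_eq_zero fun m _ => ?_
    rw [hG.christoffel_comm hy m i q, hG.christoffel_comm hy m j q, hG.christoffel_comm hy m j i,
      riem_antisymm_left y i m, riem_antisymm_left y j m, riem_antisymm_left y q m]
    ring
  linear_combination h2 - h3

end IsMetricOn

/-! ### Contractions with the inverse metric and their covariant derivatives -/

/-- The contraction `B^jl X_ijkl`. -/
def contr (B : Matrix (Fin n) (Fin n) ℝ) (X : Fin n → Fin n → Fin n → Fin n → ℝ) :
    Matrix (Fin n) (Fin n) ℝ :=
  fun i k => ∑ j, ∑ l, B j l * X i j k l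

/-- The contraction `B^pq Y_pq`. -/
def ctr (B : Matrix (Fin n) (Fin n) ℝ) (Y : Fin n → Fin n → ℝ) : ℝ :=
  ∑ p, ∑ q, B p q * Y p q

theorem ctr_congr {B : Matrix (Fin n) (Fin n) ℝ} {X Y : Fin n → Fin n → ℝ}
    (h : ∀ p q, X p q = Y p q) : ctr B X = ctr B Y := by
  simp only [ctr, h]

theorem ctr_add (B : Matrix (Fin n) (Fin n) ℝ) (X Y : Fin n → Fin n → ℝ) :
    ctr B (fun p q => X p q + Y p q) = ctr B X + ctr B Y := by
  simp only [ctr, mul_add, Finset.sum_add_distrib]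

theorem ctr_sub (B : Matrix (Fin n) (Fin n) ℝ) (X Y : Fin n → Fin n → ℝ) :
    ctr B (fun p q => X p q - Y p q) = ctr B X - ctr B Y := by
  simp only [ctr, mul_sub, Finset.sum_sub_distrib]

theorem ctr_neg (B : Matrix (Fin n) (Fin n) ℝ) (X : Fin n → Fin n → ℝ) :
    ctr B (fun p q => -X p q) = -ctr B X := by
  simp only [ctr, mul_neg, Finset.sum_neg_distrib]

theorem ctr_mul_left (B : Matrix (Fin n) (Fin n) ℝ) (c : ℝ) (X : Fin n → Fin n → ℝ) :
    ctr B (fun p q => c * X p q) = c * ctr B X := by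
  simp only [ctr, Finset.mul_sum]
  exact Finset.sum_congr rfl fun _ _ => Finset.sum_congr rfl fun _ _ => by ring

theorem ctr_mul_right (B : Matrix (Fin n) (Fin n) ℝ) (c : ℝ) (X : Fin n → Fin n → ℝ) :
    ctr B (fun p q => X p q * c) = ctr B X * c := by
  simp only [mul_comm _ c, ctr_mul_left]

theorem ctr_sum {ι : Type*} (s : Finset ι) (B : Matrix (Fin n) (Fin n) ℝ)
    (X : ι → Fin n → Fin n → ℝ) :
    ctr B (fun p q => ∑ m ∈ s, X m p q) = ∑ m ∈ s, ctr B (X m) := by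
  simp only [ctr, Finset.mul_sum]
  rw [Finset.sum_congr rfl fun p _ => Finset.sum_comm, Finset.sum_comm]

theorem ctr_comm (B C : Matrix (Fin n) (Fin n) ℝ) (X : Fin n → Fin n → Fin n → Fin n → ℝ) :
    ctr B (fun p q => ctr C fun r s => X p q r s)
      = ctr C (fun r s => ctr B fun p q => X p q r s) := by
  have h : ∀ p q, ctr C (fun r s => X p q r s) = ∑ r, ∑ s, C r s * X p q r s := fun _ _ => rfl
  simp only [h]
  rw [ctr_sum]
  simp only [ctr_sum, ctr_mul_left]
  rfl

theorem ctr_swap {B : Matrix (Fin n) (Fin n) ℝ} (hB : B.transpose = B)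
    (X : Fin n → Fin n → ℝ) : ctr B (fun p q => X q p) = ctr B X := by
  unfold ctr
  rw [Finset.sum_comm]
  refine Finset.sum_congr rfl fun p _ => Finset.sum_congr rfl fun q _ => ?_
  rw [← Matrix.transpose_apply B, hB]

theorem contr_apply (B : Matrix (Fin n) (Fin n) ℝ) (X : Fin n → Fin n → Fin n → Fin n → ℝ)
    (i k : Fin n) : contr B X i k = ctr B fun j l => X i j k l := rfl

/-- With its right-hand counterpart, moves the Γ in the derivative of the inverse metric onto the
contracted tensor, where it becomes a Christoffel correction. -/
theorem ctr_mul_connection_left (A B : Matrix (Fin n) (Fin n) ℝ) (X : Fin n → Fin n → ℝ) :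
    ctr (A * B) X = ctr B fun j l => ∑ m, A m j * X m l := by
  simp only [ctr, Matrix.mul_apply, Finset.sum_mul, Finset.mul_sum]
  rw [Finset.sum_congr rfl fun j _ => Finset.sum_comm, Finset.sum_comm,
    Finset.sum_congr rfl fun j _ => Finset.sum_comm]
  exact Finset.sum_congr rfl fun _ _ => Finset.sum_congr rfl fun _ _ =>
    Finset.sum_congr rfl fun _ _ => by ring

theorem ctr_mul_connection_right (A B : Matrix (Fin n) (Fin n) ℝ) (X : Fin n → Fin n → ℝ) :
    ctr (B * A.transpose) X = ctr B fun j l => ∑ m, A m l * X j m := by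
  simp only [ctr, Matrix.mul_apply, Finset.sum_mul, Finset.mul_sum, Matrix.transpose_apply]
  rw [Finset.sum_congr rfl fun j _ => Finset.sum_comm]
  exact Finset.sum_congr rfl fun _ _ => Finset.sum_congr rfl fun _ _ =>
    Finset.sum_congr rfl fun _ _ => by ring

theorem ctr_sub_left (A B : Matrix (Fin n) (Fin n) ℝ) (X : Fin n → Fin n → ℝ) :
    ctr (A - B) X = ctr A X - ctr B X := by
  simp only [ctr, Matrix.sub_apply, sub_mul, Finset.sum_sub_distrib]

theorem ctr_neg_left (A : Matrix (Fin n) (Fin n) ℝ) (X : Fin n → Fin n → ℝ) :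
    ctr (-A) X = -ctr A X := by
  simp only [ctr, Matrix.neg_apply, neg_mul, Finset.sum_neg_distrib]

namespace IsMetricOn

open Matrix

variable {G : EuclideanSpace ℝ (Fin n) → Matrix (Fin n) (Fin n) ℝ}
  {U : Set (EuclideanSpace ℝ (Fin n))} {y : EuclideanSpace ℝ (Fin n)}
  {S S' : EuclideanSpace ℝ (Fin n) → Matrix (Fin n) (Fin n) ℝ}
  {T T' : EuclideanSpace ℝ (Fin n) → Fin n → Fin n → Fin n → Fin n → ℝ}
  {f : EuclideanSpace ℝ (Fin n) → ℝ}

theorem contDiffOn_ctr (hG : IsMetricOn G U) {X : EuclideanSpace ℝ (Fin n) → Fin n → Fin n → ℝ}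
    (hX : ∀ i j, ContDiffOn ℝ ∞ (fun z => X z i j) U) :
    ContDiffOn ℝ ∞ (fun z => ctr (G z)⁻¹ (X z)) U :=
  ContDiffOn.sum fun p _ => ContDiffOn.sum fun q _ => (hG.smooth_inv p q).mul (hX p q)

/-- Contraction with the inverse metric, under a partial derivative. -/
theorem pd_ctr (hG : IsMetricOn G U) (hy : y ∈ U)
    {X : EuclideanSpace ℝ (Fin n) → Fin n → Fin n → ℝ}
    (hX : ∀ i j, ContDiffOn ℝ ∞ (fun z => X z i j) U) (c : Fin n) :
    pd c (fun z => ctr (G z)⁻¹ (X z)) y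
      = ctr (G y)⁻¹ fun i j => pd c (fun z => X z i j) y
        - ∑ m, (christoffel G m c i y * X y m j + christoffel G m c j y * X y i m) := by
  have dI := fun a b => hG.smooth_inv.differentiableAt hG.isOpen hy a b
  have dX := fun a b => differentiableAt_of_contDiffOn hG.isOpen (hX a b) hy
  have h1 : pd c (fun z => ctr (G z)⁻¹ (X z)) y
      = ctr (pdM c (fun z => (G z)⁻¹) y) (X y)
        + ctr (G y)⁻¹ fun i j => pd c (fun z => X z i j) y := by
    simp only [ctr]
    rw [pd_sum, ← Finset.sum_add_distrib]
    · refine Finset.sum_congr rfl fun p _ => ?_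
      rw [pd_sum, ← Finset.sum_add_distrib]
      · exact Finset.sum_congr rfl fun q _ => pd_mul c (dI p q) (dX p q)
      · exact fun q _ => (dI p q).fun_mul (dX p q)
    · exact fun p _ => DifferentiableAt.fun_sum fun q _ => (dI p q).fun_mul (dX p q)
  rw [h1, hG.pdM_inv hy, ctr_sub_left, ctr_neg_left, ctr_mul_connection_left,
    ctr_mul_connection_right, ctr_sub]
  simp only [Finset.sum_add_distrib, ctr_add, gam]
  ring

theorem smooth_contr (hG : IsMetricOn G U) (hT : SmoothTensor U T) :
    SmoothMat U (fun z => contr (G z)⁻¹ (T z)) := fun i k =>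
  hG.contDiffOn_ctr fun j l => hT i j k l

/-- Covariant differentiation commutes with the trace: the derivative of the inverse metric supplies
exactly the Christoffel corrections of the two contracted indices. -/
theorem nab2_contr (hG : IsMetricOn G U) (hy : y ∈ U) (hT : SmoothTensor U T) (c : Fin n) :
    nab2 G c (fun z => contr (G z)⁻¹ (T z)) y = contr (G y)⁻¹ (nab4 G c T y) := by
  ext i k
  have h := hG.pd_ctr hy (X := fun z j l => T z i j k l) (fun j l => hT i j k l) c
  simp only [nab2, contr_apply, nab4, act4, gam]
  rw [h, ctr_sub, ctr_sub]
  simp only [Finset.sum_add_distrib, ctr_add, ctr_sum, ctr_mul_left]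
  ring

theorem pd_ctr_nab2 (hG : IsMetricOn G U) (hy : y ∈ U) (hS : SmoothMat U S) (c : Fin n) :
    pd c (fun z => ctr (G z)⁻¹ (S z)) y = ctr (G y)⁻¹ (nab2 G c S y) :=
  hG.pd_ctr hy (X := S) hS c

theorem nab2_congr (hG : IsMetricOn G U) (hy : y ∈ U) (c : Fin n) (h : ∀ z ∈ U, S z = S' z) :
    nab2 G c S y = nab2 G c S' y := by
  rw [nab2_eq, nab2_eq, pdM_congr hG.isOpen hy c h, h y hy]

theorem nab4_congr (hG : IsMetricOn G U) (hy : y ∈ U) (c : Fin n)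
    (h : ∀ z ∈ U, ∀ i j k l, T z i j k l = T' z i j k l) (i j k l : Fin n) :
    nab4 G c T y i j k l = nab4 G c T' y i j k l := by
  simp only [nab4, act4, h y hy]
  rw [pd_congr hG.isOpen hy c fun z hz => h z hz i j k l]

theorem hess4_congr (hG : IsMetricOn G U) (hy : y ∈ U)
    (h : ∀ z ∈ U, ∀ i j k l, T z i j k l = T' z i j k l) (p q i j k l : Fin n) :
    hess4 G T y p q i j k l = hess4 G T' y p q i j k l := by
  simp only [hess4]
  rw [hG.nab4_congr hy p fun z hz => hG.nab4_congr hz q h]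
  simp only [hG.nab4_congr hy _ h]

theorem hess2_contr (hG : IsMetricOn G U) (hy : y ∈ U) (hT : SmoothTensor U T) (p q : Fin n) :
    hess2 G (fun z => contr (G z)⁻¹ (T z)) y p q = contr (G y)⁻¹ (hess4 G T y p q) := by
  ext i k
  simp only [hess2, hess4, contr_apply]
  rw [hG.nab2_congr hy p fun z hz => hG.nab2_contr hz hT q,
    hG.nab2_contr hy (hG.smooth_nab4 hT q), ctr_sub, ctr_sum]
  simp only [hG.nab2_contr hy hT, ctr_mul_left, contr_apply]

theorem hess0_ctr (hG : IsMetricOn G U) (hy : y ∈ U) (hS : SmoothMat U S) (p q : Fin n) :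
    hess0 G (fun z => ctr (G z)⁻¹ (S z)) y p q = ctr (G y)⁻¹ (hess2 G S y p q) := by
  have h : hess2 G S y p q = fun i j => nab2 G p (nab2 G q S) y i j
    - ∑ m, christoffel G m p q y * nab2 G m S y i j := rfl
  rw [hess0, pd_congr hG.isOpen hy p fun z hz => hG.pd_ctr_nab2 hz hS q,
    hG.pd_ctr_nab2 hy (hG.smooth_nab2 hS q), h]
  refine Eq.trans ?_ (ctr_sub (G y)⁻¹ (fun i j => nab2 G p (nab2 G q S) y i j)
    fun i j => ∑ m, christoffel G m p q y * nab2 G m S y i j).symm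
  rw [ctr_sum]
  congr 1
  refine Finset.sum_congr rfl fun m _ => ?_
  rw [hG.pd_ctr_nab2 hy hS]
  exact (ctr_mul_left (G y)⁻¹ _ fun i j => nab2 G m S y i j).symm

theorem nab2_smul_metric (hG : IsMetricOn G U) (hy : y ∈ U) (hf : ContDiffOn ℝ ∞ f U)
    (c : Fin n) : nab2 G c (fun z => f z • G z) y = pd c f y • G y := by
  ext i j
  have h := congrFun (congrFun (hG.pdM_metric hy c) i) j
  simp only [pdM, Matrix.add_apply, Matrix.mul_apply, Matrix.transpose_apply, gam] at h
  simp only [nab2, Matrix.smul_apply, smul_eq_mul]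
  rw [pd_mul c (differentiableAt_of_contDiffOn hG.isOpen hf hy)
    (hG.smooth.differentiableAt hG.isOpen hy i j), h]
  have e1 : ∑ m, christoffel G m c i y * (f y * G y m j)
      = f y * ∑ m, christoffel G m c i y * G y m j := by
    rw [Finset.mul_sum]
    exact Finset.sum_congr rfl fun _ _ => by ring
  have e2 : ∑ m, christoffel G m c j y * (f y * G y i m)
      = f y * ∑ m, G y i m * christoffel G m c j y := by
    rw [Finset.mul_sum]
    exact Finset.sum_congr rfl fun _ _ => by ring
  rw [Finset.sum_add_distrib, e1, e2]
  ring

theorem hess2_smul_metric (hG : IsMetricOn G U) (hy : y ∈ U) (hf : ContDiffOn ℝ ∞ f U)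
    (p q : Fin n) : hess2 G (fun z => f z • G z) y p q = hess0 G f y p q • G y := by
  ext i j
  simp only [hess2, hess0]
  rw [hG.nab2_congr hy p fun z hz => hG.nab2_smul_metric hz hf q,
    hG.nab2_smul_metric hy (contDiffOn_pd hG.isOpen hf q)]
  simp only [hG.nab2_smul_metric hy hf, Matrix.smul_apply, smul_eq_mul, sub_mul, Finset.sum_mul,
    mul_assoc]

theorem nab2_linear (hG : IsMetricOn G U) (hy : y ∈ U) (hS : SmoothMat U S)
    (hS' : SmoothMat U S') (a b : ℝ) (c : Fin n) :
    nab2 G c (fun z => a • S z + b • S' z) y = a • nab2 G c S y + b • nab2 G c S' y := by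
  ext i j
  have d1 := hS.differentiableAt hG.isOpen hy i j
  have d2 := hS'.differentiableAt hG.isOpen hy i j
  simp only [nab2, Matrix.add_apply, Matrix.smul_apply, smul_eq_mul]
  rw [pd_add c (d1.const_mul a) (d2.const_mul b), pd_const_mul c a d1, pd_const_mul c b d2]
  simp only [Finset.sum_add_distrib, mul_add, mul_sub, Finset.mul_sum, mul_left_comm]
  ring

theorem hess2_linear (hG : IsMetricOn G U) (hy : y ∈ U) (hS : SmoothMat U S)
    (hS' : SmoothMat U S') (a b : ℝ) (p q : Fin n) :
    hess2 G (fun z => a • S z + b • S' z) y p q = a • hess2 G S y p q + b • hess2 G S' y p q := by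
  ext i j
  simp only [hess2, Matrix.add_apply, Matrix.smul_apply, smul_eq_mul]
  rw [hG.nab2_congr hy p fun z hz => hG.nab2_linear hz hS hS' a b q,
    hG.nab2_linear hy (hG.smooth_nab2 hS q) (hG.smooth_nab2 hS' q)]
  simp only [hG.nab2_linear hy hS hS', Matrix.add_apply, Matrix.smul_apply, smul_eq_mul,
    Finset.sum_add_distrib, mul_add, mul_sub, Finset.mul_sum, mul_left_comm]
  ring

theorem nab4_add_const_mul (hG : IsMetricOn G U) (hy : y ∈ U) (hT : SmoothTensor U T)
    (hT' : SmoothTensor U T') (b : ℝ) (c i j k l : Fin n) :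
    nab4 G c (fun z i j k l => T z i j k l + b * T' z i j k l) y i j k l
      = nab4 G c T y i j k l + b * nab4 G c T' y i j k l := by
  have d1 := differentiableAt_of_contDiffOn hG.isOpen (hT i j k l) hy
  have d2 := differentiableAt_of_contDiffOn hG.isOpen (hT' i j k l) hy
  simp only [nab4, act4]
  rw [pd_add c d1 (d2.const_mul b), pd_const_mul c b d2]
  simp only [Finset.sum_add_distrib, mul_add, mul_sub, Finset.mul_sum, mul_left_comm]
  ring

theorem hess4_add_const_mul (hG : IsMetricOn G U) (hy : y ∈ U) (hT : SmoothTensor U T)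
    (hT' : SmoothTensor U T') (b : ℝ) (p q i j k l : Fin n) :
    hess4 G (fun z i j k l => T z i j k l + b * T' z i j k l) y p q i j k l
      = hess4 G T y p q i j k l + b * hess4 G T' y p q i j k l := by
  simp only [hess4]
  rw [hG.nab4_congr hy p fun z hz => hG.nab4_add_const_mul hz hT hT' b q,
    hG.nab4_add_const_mul hy (hG.smooth_nab4 hT q) (hG.smooth_nab4 hT' q)]
  simp only [hG.nab4_add_const_mul hy hT hT', Finset.sum_add_distrib, mul_add, mul_sub,
    Finset.mul_sum, mul_left_comm]
  ring

theorem smooth_kulkarniNomizu (hG : IsMetricOn G U) (hS : SmoothMat U S) :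
    SmoothTensor U (fun z => kulkarniNomizu (S z) (G z)) := by
  have g := hG.smooth
  intro i j k l
  exact ((((hS i k).mul (g j l)).add ((hS j l).mul (g i k))).sub ((hS i l).mul (g j k))).sub
    ((hS j k).mul (g i l))

/-- The Leibniz rule, in which the terms differentiating the parallel metric vanish. -/
theorem nab4_kulkarniNomizu (hG : IsMetricOn G U) (hy : y ∈ U) (hS : SmoothMat U S)
    (c i j k l : Fin n) :
    nab4 G c (fun z => kulkarniNomizu (S z) (G z)) y i j k l
      = kulkarniNomizu (nab2 G c S y) (G y) i j k l := by
  have dS := fun a b => hS.differentiableAt hG.isOpen hy a b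
  have dG := fun a b => hG.smooth.differentiableAt hG.isOpen hy a b
  have h : ∀ a b, pd c (fun z => G z a b) y = ∑ m, christoffel G m c a y * G y m b
      + ∑ m, christoffel G m c b y * G y a m := by
    intro a b
    have h := congrFun (congrFun (hG.pdM_metric hy c) a) b
    simp only [pdM, Matrix.add_apply, Matrix.mul_apply, Matrix.transpose_apply, gam] at h
    rw [h]
    simp only [mul_comm]
  simp only [nab4, act4, kulkarniNomizu, nab2, gam]
  rw [pd_sub, pd_sub, pd_add, pd_mul c (dS _ _) (dG _ _), pd_mul c (dS _ _) (dG _ _),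
    pd_mul c (dS _ _) (dG _ _), pd_mul c (dS _ _) (dG _ _)]
  · simp only [h, Finset.sum_add_distrib, mul_add, mul_sub, sub_mul, add_mul, Finset.mul_sum,
      Finset.sum_mul, Finset.sum_sub_distrib, mul_assoc, mul_left_comm (S y _ _)]
    ring
  all_goals fun_prop (disch := first | exact dS _ _ | exact dG _ _)

theorem hess4_kulkarniNomizu (hG : IsMetricOn G U) (hy : y ∈ U) (hS : SmoothMat U S)
    (p q i j k l : Fin n) :
    hess4 G (fun z => kulkarniNomizu (S z) (G z)) y p q i j k l
      = kulkarniNomizu (hess2 G S y p q) (G y) i j k l := by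
  simp only [hess4]
  rw [hG.nab4_congr hy p fun z hz => hG.nab4_kulkarniNomizu hz hS q,
    hG.nab4_kulkarniNomizu hy (hG.smooth_nab2 hS q)]
  simp only [hG.nab4_kulkarniNomizu hy hS, kulkarniNomizu, hess2, sub_mul, Finset.sum_mul, mul_add,
    mul_sub, Finset.sum_add_distrib, Finset.sum_sub_distrib, mul_assoc]
  ring

/-! ### Symmetries of the second covariant derivative of the curvature tensor -/

theorem nab4_antisymm_left (hG : IsMetricOn G U) (hy : y ∈ U)
    (h : ∀ z ∈ U, ∀ i j k l, T z i j k l = -T z j i k l) (c i j k l : Fin n) :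
    nab4 G c T y i j k l = -nab4 G c T y j i k l := by
  simp only [nab4, act4]
  rw [pd_congr hG.isOpen hy c fun z hz => h z hz i j k l, pd_neg, neg_sub', sub_right_inj,
    ← Finset.sum_neg_distrib]
  refine Finset.sum_congr rfl fun m _ => ?_
  rw [h y hy m j, h y hy i m, h y hy i j m l, h y hy i j k m]
  ring

theorem nab4_antisymm_right (hG : IsMetricOn G U) (hy : y ∈ U)
    (h : ∀ z ∈ U, ∀ i j k l, T z i j k l = -T z i j l k) (c i j k l : Fin n) :
    nab4 G c T y i j k l = -nab4 G c T y i j l k := by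
  simp only [nab4, act4]
  rw [pd_congr hG.isOpen hy c fun z hz => h z hz i j k l, pd_neg, neg_sub', sub_right_inj,
    ← Finset.sum_neg_distrib]
  refine Finset.sum_congr rfl fun m _ => ?_
  rw [h y hy m j, h y hy i m, h y hy i j m l, h y hy i j k m]
  ring

theorem nab4_pair_symm (hG : IsMetricOn G U) (hy : y ∈ U)
    (h : ∀ z ∈ U, ∀ i j k l, T z i j k l = T z k l i j) (c i j k l : Fin n) :
    nab4 G c T y i j k l = nab4 G c T y k l i j := by
  simp only [nab4, act4]
  rw [pd_congr hG.isOpen hy c fun z hz => h z hz i j k l, sub_right_inj]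
  refine Finset.sum_congr rfl fun m _ => ?_
  rw [h y hy m j, h y hy i m, h y hy i j m l, h y hy i j k m]
  ring

theorem hess4_antisymm_left (hG : IsMetricOn G U) (hy : y ∈ U)
    (h : ∀ z ∈ U, ∀ i j k l, T z i j k l = -T z j i k l) (p q i j k l : Fin n) :
    hess4 G T y p q i j k l = -hess4 G T y p q j i k l := by
  simp only [hess4]
  rw [hG.nab4_antisymm_left hy fun z hz => hG.nab4_antisymm_left hz h q, neg_sub', sub_right_inj,
    ← Finset.sum_neg_distrib]
  exact Finset.sum_congr rfl fun m _ => by rw [hG.nab4_antisymm_left hy h]; ring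

theorem hess4_antisymm_right (hG : IsMetricOn G U) (hy : y ∈ U)
    (h : ∀ z ∈ U, ∀ i j k l, T z i j k l = -T z i j l k) (p q i j k l : Fin n) :
    hess4 G T y p q i j k l = -hess4 G T y p q i j l k := by
  simp only [hess4]
  rw [hG.nab4_antisymm_right hy fun z hz => hG.nab4_antisymm_right hz h q, neg_sub', sub_right_inj,
    ← Finset.sum_neg_distrib]
  exact Finset.sum_congr rfl fun m _ => by rw [hG.nab4_antisymm_right hy h]; ring

theorem hess4_pair_symm (hG : IsMetricOn G U) (hy : y ∈ U)
    (h : ∀ z ∈ U, ∀ i j k l, T z i j k l = T z k l i j) (p q i j k l : Fin n) :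
    hess4 G T y p q i j k l = hess4 G T y p q k l i j := by
  simp only [hess4]
  rw [hG.nab4_pair_symm hy fun z hz => hG.nab4_pair_symm hz h q, sub_right_inj]
  exact Finset.sum_congr rfl fun m _ => by rw [hG.nab4_pair_symm hy h]

/-- Differentiating the second Bianchi identity permutes q with i and j, so q has to count as a
tensor index as well. The Christoffel corrections then group into five families, each being the
Bianchi identity with one of i, j, k, l, q replaced by m. -/
theorem hess4_riem_bianchi (hG : IsMetricOn G U) (hy : y ∈ U) (p q i j k l : Fin n) :
    hess4 G (riem G) y p q i j k l + hess4 G (riem G) y p i j q k l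
      + hess4 G (riem G) y p j q i k l = 0 := by
  have hN := fun q i j k l => differentiableAt_of_contDiffOn hG.isOpen
    (hG.smooth_nab4 hG.smooth_riem q i j k l) hy
  have b := hG.nab4_riem_bianchi hy
  have h0 : pd p (fun z => nab4 G q (riem G) z i j k l) y
      + pd p (fun z => nab4 G i (riem G) z j q k l) y
      + pd p (fun z => nab4 G j (riem G) z q i k l) y = 0 := by
    rw [← pd_add p (hN _ _ _ _ _) (hN _ _ _ _ _),
      ← pd_add p ((hN _ _ _ _ _).fun_add (hN _ _ _ _ _)) (hN _ _ _ _ _),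
      pd_congr hG.isOpen hy p fun z hz => hG.nab4_riem_bianchi hz q i j k l, pd_const]
  have h1 : ∀ q i j, hess4 G (riem G) y p q i j k l
      = pd p (fun z => nab4 G q (riem G) z i j k l) y
        - ∑ m, (christoffel G m p i y * nab4 G q (riem G) y m j k l
          + christoffel G m p j y * nab4 G q (riem G) y i m k l
          + christoffel G m p k y * nab4 G q (riem G) y i j m l
          + christoffel G m p l y * nab4 G q (riem G) y i j k m
          + christoffel G m p q y * nab4 G m (riem G) y i j k l) := by
    intro q i j
    rw [Finset.sum_add_distrib, ← sub_sub]
    rfl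
  have h2 : ∀ (s t u : Fin n → ℝ), (∀ m, s m + t m + u m = 0) →
      ∑ m, s m + ∑ m, t m + ∑ m, u m = 0 := by
    intro s t u h
    rw [← Finset.sum_add_distrib, ← Finset.sum_add_distrib]
    exact Finset.sum_eq_zero fun m _ => h m
  have h3 := h2
    (fun m => christoffel G m p i y * nab4 G q (riem G) y m j k l
          + christoffel G m p j y * nab4 G q (riem G) y i m k l
          + christoffel G m p k y * nab4 G q (riem G) y i j m l
          + christoffel G m p l y * nab4 G q (riem G) y i j k m
          + christoffel G m p q y * nab4 G m (riem G) y i j k l)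
    (fun m => christoffel G m p j y * nab4 G i (riem G) y m q k l
          + christoffel G m p q y * nab4 G i (riem G) y j m k l
          + christoffel G m p k y * nab4 G i (riem G) y j q m l
          + christoffel G m p l y * nab4 G i (riem G) y j q k m
          + christoffel G m p i y * nab4 G m (riem G) y j q k l)
    (fun m => christoffel G m p q y * nab4 G j (riem G) y m i k l
          + christoffel G m p i y * nab4 G j (riem G) y q m k l
          + christoffel G m p k y * nab4 G j (riem G) y q i m l
          + christoffel G m p l y * nab4 G j (riem G) y q i k m
          + christoffel G m p j y * nab4 G m (riem G) y q i k l)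
    (fun m => by
      linear_combination christoffel G m p i y * b q m j k l + christoffel G m p j y * b q i m k l
        + christoffel G m p k y * b q i j m l + christoffel G m p l y * b q i j k m
        + christoffel G m p q y * b m i j k l)
  rw [h1, h1, h1]
  linear_combination h0 - h3

end IsMetricOn

/-- The rough Laplacian of a covariant tensor field of order four. -/
theorem laplacian_eq_ctr_hess4 (G : EuclideanSpace ℝ (Fin n) → Matrix (Fin n) (Fin n) ℝ)
    (T : EuclideanSpace ℝ (Fin n) → Fin n → Fin n → Fin n → Fin n → ℝ)
    (y : EuclideanSpace ℝ (Fin n)) (i j k l : Fin n) :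
    laplacian G (fun z (a : Fin 4 → Fin n) => T z (a 0) (a 1) (a 2) (a 3)) y ![i, j, k, l]
      = ctr (G y)⁻¹ fun p q => hess4 G T y p q i j k l := by
  have h1 : ∀ (z : EuclideanSpace ℝ (Fin n)) (a : Fin 5 → Fin n),
      covDeriv G (fun z (a : Fin 4 → Fin n) => T z (a 0) (a 1) (a 2) (a 3)) z a
        = nab4 G (a 0) T z (a 1) (a 2) (a 3) (a 4) := by
    intro z a
    simp only [covDeriv, nab4, act4, gam, Fin.sum_univ_four, Finset.sum_add_distrib]
    rfl
  have h2 : covDeriv G (fun z (a : Fin 4 → Fin n) => T z (a 0) (a 1) (a 2) (a 3))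
      = fun z a => nab4 G (a 0) T z (a 1) (a 2) (a 3) (a 4) := by
    funext z a
    exact h1 z a
  rw [laplacian, ctr, h2]
  refine Finset.sum_congr rfl fun p _ => Finset.sum_congr rfl fun q _ => ?_
  congr 1
  have h3 : hess4 G T y p q i j k l = pd p (fun z => nab4 G q T z i j k l) y
      - act4 (gam G p y) (nab4 G q T y) i j k l
      - ∑ m, christoffel G m p q y * nab4 G m T y i j k l := rfl
  -- In the order-five tensor ∇T the direction q is slot 0, so its correction must precede those of
  -- i, j, k, l.
  rw [h3, sub_sub, add_comm (act4 _ _ _ _ _ _)]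
  simp only [covDeriv, act4, gam, Finset.sum_add_distrib, Fin.sum_univ_five (M := ℝ),
    ← add_assoc]
  rfl

/-! ### Functions of time and space -/

section TimeDerivative

variable {J : Set ℝ} {U : Set (EuclideanSpace ℝ (Fin n))} {f : ℝ → EuclideanSpace ℝ (Fin n) → ℝ}
  {t : ℝ} {y : EuclideanSpace ℝ (Fin n)}

theorem nonempty_interior_of_ordConnected (hJ : J.OrdConnected) (hJ' : J.Nontrivial) :
    (interior J).Nonempty := by
  obtain ⟨a, ha, b, hb, hab⟩ := hJ'.exists_lt
  have h : Set.Ioo a b ⊆ interior J :=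
    interior_maximal (Set.Ioo_subset_Icc_self.trans (hJ.out ha hb)) isOpen_Ioo
  exact (Set.nonempty_Ioo.2 hab).mono h

theorem uniqueDiffOn_of_ordConnected (hJ : J.OrdConnected) (hJ' : J.Nontrivial) :
    UniqueDiffOn ℝ J :=
  uniqueDiffOn_convex hJ.convex (nonempty_interior_of_ordConnected hJ hJ')

/-- Symmetry of second derivatives within a set holds at points in the closure of its interior. This
covers end points of J and is where J must have more than one point. -/
theorem mem_closure_interior_prod (hJ : J.OrdConnected) (hJ' : J.Nontrivial) (hU : IsOpen U)
    (ht : t ∈ J) (hy : y ∈ U) : (t, y) ∈ closure (interior (J ×ˢ U)) := by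
  rw [interior_prod_eq, hU.interior_eq, closure_prod_eq]
  refine ⟨?_, subset_closure hy⟩
  rw [Convex.closure_interior_eq_closure_of_nonempty_interior (𝕜 := ℝ) hJ.convex
    (nonempty_interior_of_ordConnected hJ hJ')]
  exact subset_closure ht

theorem hasDerivWithinAt_slice {F : ℝ × EuclideanSpace ℝ (Fin n) → ℝ}
    {L : ℝ × EuclideanSpace ℝ (Fin n) →L[ℝ] ℝ} (hy : y ∈ U)
    (h : HasFDerivWithinAt F L (J ×ˢ U) (t, y)) :
    HasDerivWithinAt (fun s => F (s, y)) (L (1, 0)) J t := by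
  have h1 : HasDerivWithinAt (fun s : ℝ => (s, y)) ((1 : ℝ), (0 : EuclideanSpace ℝ (Fin n))) J t :=
    (hasDerivWithinAt_id t J).prodMk (hasDerivWithinAt_const t J y)
  have h2 : Set.MapsTo (fun s : ℝ => (s, y)) J (J ×ˢ U) := fun s hs => ⟨hs, hy⟩
  exact h.comp_hasDerivWithinAt t h1 h2

theorem pd_slice {F : ℝ × EuclideanSpace ℝ (Fin n) → ℝ}
    {L : ℝ × EuclideanSpace ℝ (Fin n) →L[ℝ] ℝ} (hU : IsOpen U) (ht : t ∈ J) (hy : y ∈ U)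
    (h : HasFDerivWithinAt F L (J ×ˢ U) (t, y)) (k : Fin n) :
    pd k (fun z => F (t, z)) y = L (0, EuclideanSpace.single k 1) := by
  have h1 : HasFDerivWithinAt (fun z : EuclideanSpace ℝ (Fin n) => (t, z))
      ((0 : EuclideanSpace ℝ (Fin n) →L[ℝ] ℝ).prod (ContinuousLinearMap.id ℝ _)) U y :=
    (hasFDerivWithinAt_const t y U).prodMk (hasFDerivWithinAt_id y U)
  have h2 := (h.comp y h1 fun z hz => ⟨ht, hz⟩).hasFDerivAt (hU.mem_nhds hy)
  have h3 : fderiv ℝ (fun z => F (t, z)) y = _ := h2.fderiv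
  rw [pd, h3]
  simp

theorem contDiffOn_pd_prod (hJ : J.OrdConnected) (hJ' : J.Nontrivial) (hU : IsOpen U)
    (hf : ContDiffOn ℝ ∞ (fun q : ℝ × EuclideanSpace ℝ (Fin n) => f q.1 q.2) (J ×ˢ U))
    (k : Fin n) :
    ContDiffOn ℝ ∞ (fun q : ℝ × EuclideanSpace ℝ (Fin n) => pd k (f q.1) q.2) (J ×ˢ U) := by
  have hs : UniqueDiffOn ℝ (J ×ˢ U) :=
    (uniqueDiffOn_of_ordConnected hJ hJ').prod hU.uniqueDiffOn
  have h1 := (hf.fderivWithin hs (m := ∞) (by simp)).clm_apply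
    (contDiffOn_const (c := ((0 : ℝ), EuclideanSpace.single k (1 : ℝ))))
  refine h1.congr fun q hq => ?_
  exact pd_slice (F := fun q => f q.1 q.2) hU hq.1 hq.2
    ((hf.differentiableOn (by simp) q hq).hasFDerivWithinAt) k

/-- Time and space derivatives commute. -/
theorem hasDerivWithinAt_pd (hJ : J.OrdConnected) (hJ' : J.Nontrivial) (hU : IsOpen U)
    (hf : ContDiffOn ℝ ∞ (fun q : ℝ × EuclideanSpace ℝ (Fin n) => f q.1 q.2) (J ×ˢ U))
    (ht : t ∈ J) {F : EuclideanSpace ℝ (Fin n) → ℝ}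
    (hF : ∀ z ∈ U, HasDerivWithinAt (fun s => f s z) (F z) J t) (hy : y ∈ U) (k : Fin n) :
    HasDerivWithinAt (fun s => pd k (f s) y) (pd k F y) J t := by
  set Φ : ℝ × EuclideanSpace ℝ (Fin n) → ℝ := fun q => f q.1 q.2 with hΦ
  have hs : UniqueDiffOn ℝ (J ×ˢ U) :=
    (uniqueDiffOn_of_ordConnected hJ hJ').prod hU.uniqueDiffOn
  have hd : ∀ q ∈ J ×ˢ U, HasFDerivWithinAt Φ (fderivWithin ℝ Φ (J ×ˢ U) q) (J ×ˢ U) q :=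
    fun q hq => (hf.differentiableOn (by simp) q hq).hasFDerivWithinAt
  have hd2 : HasFDerivWithinAt (fderivWithin ℝ Φ (J ×ˢ U))
      (fderivWithin ℝ (fderivWithin ℝ Φ (J ×ˢ U)) (J ×ˢ U) (t, y)) (J ×ˢ U) (t, y) :=
    ((hf.fderivWithin hs (m := ∞) (by simp)).differentiableOn (by simp) (t, y)
      ⟨ht, hy⟩).hasFDerivWithinAt
  have hsymm : IsSymmSndFDerivWithinAt ℝ Φ (J ×ˢ U) (t, y) :=
    (hf (t, y) ⟨ht, hy⟩).isSymmSndFDerivWithinAt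
      (by simpa using (by exact_mod_cast le_top :
        ((2 : ℕ∞) : WithTop ℕ∞) ≤ ((⊤ : ℕ∞) : WithTop ℕ∞))) hs
      (mem_closure_interior_prod hJ hJ' hU ht hy) ⟨ht, hy⟩
  have happ : ∀ v : ℝ × EuclideanSpace ℝ (Fin n),
      HasFDerivWithinAt (fun q => fderivWithin ℝ Φ (J ×ˢ U) q v)
        ((ContinuousLinearMap.apply ℝ ℝ v).comp
          (fderivWithin ℝ (fderivWithin ℝ Φ (J ×ˢ U)) (J ×ˢ U) (t, y))) (J ×ˢ U) (t, y) :=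
    fun v => (ContinuousLinearMap.apply ℝ ℝ v).hasFDerivAt.comp_hasFDerivWithinAt (t, y) hd2
  -- `F` is known only as a pointwise one-sided derivative; uniqueness of derivatives within J
  -- identifies it with the joint derivative in direction (1, 0), which can be differentiated in
  -- space.
  have hFv : ∀ z ∈ U, F z = fderivWithin ℝ Φ (J ×ˢ U) (t, z) (1, 0) := fun z hz =>
    (uniqueDiffOn_of_ordConnected hJ hJ' t ht).eq_deriv _ (hF z hz)
      (hasDerivWithinAt_slice hz (hd (t, z) ⟨ht, hz⟩))
  have h1 := hasDerivWithinAt_slice hy (happ (0, EuclideanSpace.single k 1))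
  have h2 := pd_slice hU ht hy (happ (1, 0)) k
  rw [pd_congr hU hy k hFv, h2]
  have h3 : HasDerivWithinAt (fun s => pd k (f s) y) _ J t :=
    h1.congr_of_mem (fun s hs => pd_slice (F := Φ) hU hs hy (hd (s, y) ⟨hs, hy⟩) k) ht
  convert h3 using 1
  exact hsymm _ _

end TimeDerivative

/-! ### Variation of the curvature along a family of metrics -/

/-- `G` is a family of metrics on `U`, smooth in time and space for times in `J`. -/
structure IsMetricFamilyOn (G : ℝ → EuclideanSpace ℝ (Fin n) → Matrix (Fin n) (Fin n) ℝ)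
    (J : Set ℝ) (U : Set (EuclideanSpace ℝ (Fin n))) : Prop where
  ordConnected : J.OrdConnected
  nontrivial : J.Nontrivial
  isOpen : IsOpen U
  smooth : ∀ i j, ContDiffOn ℝ ∞ (fun q : ℝ × EuclideanSpace ℝ (Fin n) => G q.1 q.2 i j) (J ×ˢ U)
  symm : ∀ s ∈ J, ∀ y ∈ U, (G s y).transpose = G s y
  det : ∀ s ∈ J, ∀ y ∈ U, IsUnit (G s y).det

/-- The variation of the Christoffel symbols, with the upper index lowered:
`½ (∇_i h_jl + ∇_j h_il - ∇_l h_ij)`. -/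
def varGamLow (G : EuclideanSpace ℝ (Fin n) → Matrix (Fin n) (Fin n) ℝ)
    (h : EuclideanSpace ℝ (Fin n) → Matrix (Fin n) (Fin n) ℝ) (i : Fin n)
    (y : EuclideanSpace ℝ (Fin n)) : Matrix (Fin n) (Fin n) ℝ :=
  fun j l => (1 / 2) * (nab2 G i h y j l + nab2 G j h y i l - nab2 G l h y i j)

/-- The variation of the connection matrices. -/
def varGam (G : EuclideanSpace ℝ (Fin n) → Matrix (Fin n) (Fin n) ℝ)
    (h : EuclideanSpace ℝ (Fin n) → Matrix (Fin n) (Fin n) ℝ) (i : Fin n)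
    (y : EuclideanSpace ℝ (Fin n)) : Matrix (Fin n) (Fin n) ℝ :=
  (G y)⁻¹ * (varGamLow G h i y).transpose

namespace IsMetricFamilyOn

open Matrix

variable {J : Set ℝ} {U : Set (EuclideanSpace ℝ (Fin n))}
  {G : ℝ → EuclideanSpace ℝ (Fin n) → Matrix (Fin n) (Fin n) ℝ}
  {h : EuclideanSpace ℝ (Fin n) → Matrix (Fin n) (Fin n) ℝ}
  {t : ℝ} {y : EuclideanSpace ℝ (Fin n)}

theorem isMetricOn (hG : IsMetricFamilyOn G J U) (ht : t ∈ J) : IsMetricOn (G t) U where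
  isOpen := hG.isOpen
  smooth i j := (hG.smooth i j).comp (contDiffOn_const.prodMk contDiffOn_id)
    fun _ hz => ⟨ht, hz⟩
  symm := hG.symm t ht
  det := hG.det t ht

theorem smooth_inv (hG : IsMetricFamilyOn G J U) (i j : Fin n) :
    ContDiffOn ℝ ∞ (fun q : ℝ × EuclideanSpace ℝ (Fin n) => (G q.1 q.2)⁻¹ i j) (J ×ˢ U) :=
  contDiffOn_matrix_inv (A := fun q : ℝ × EuclideanSpace ℝ (Fin n) => G q.1 q.2) hG.smooth
    (fun q hq => hG.det q.1 hq.1 q.2 hq.2) i j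

theorem smooth_christoffel (hG : IsMetricFamilyOn G J U) (k i j : Fin n) :
    ContDiffOn ℝ ∞ (fun q : ℝ × EuclideanSpace ℝ (Fin n) => christoffel (G q.1) k i j q.2)
      (J ×ˢ U) := by
  have hp : ∀ c a b, ContDiffOn ℝ ∞
      (fun q : ℝ × EuclideanSpace ℝ (Fin n) => pd c (fun z => G q.1 z a b) q.2) (J ×ˢ U) :=
    fun c a b => contDiffOn_pd_prod hG.ordConnected hG.nontrivial hG.isOpen
      (f := fun s z => G s z a b) (hG.smooth a b) c
  exact contDiffOn_const.mul (ContDiffOn.sum fun l _ =>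
    (hG.smooth_inv k l).mul (((hp i j l).add (hp j i l)).sub (hp l i j)))

/-- Differentiability comes from joint smoothness; the value then follows by differentiating G⁻¹G =
1. -/
theorem hasDerivWithinAt_inv (hG : IsMetricFamilyOn G J U) (ht : t ∈ J) (hy : y ∈ U)
    (hh : ∀ i j, HasDerivWithinAt (fun s => G s y i j) (h y i j) J t) (i j : Fin n) :
    HasDerivWithinAt (fun s => (G s y)⁻¹ i j) (-((G t y)⁻¹ * h y * (G t y)⁻¹) i j) J t := by
  have hd : ∀ a b, DifferentiableWithinAt ℝ (fun s => (G s y)⁻¹ a b) J t := fun a b =>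
    (hasDerivWithinAt_slice hy ((hG.smooth_inv a b).differentiableOn (by simp) (t, y)
      ⟨ht, hy⟩).hasFDerivWithinAt).differentiableWithinAt
  set D : Matrix (Fin n) (Fin n) ℝ := fun a b => derivWithin (fun s => (G s y)⁻¹ a b) J t with hD
  have hu := uniqueDiffOn_of_ordConnected hG.ordConnected hG.nontrivial t ht
  have h1 : D * G t y + (G t y)⁻¹ * h y = 0 := by
    ext a b
    have e1 : HasDerivWithinAt (fun s => ∑ m, (G s y)⁻¹ a m * G s y m b)
        (∑ m, (D a m * G t y m b + (G t y)⁻¹ a m * h y m b)) J t :=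
      HasDerivWithinAt.fun_sum fun m _ => (hd a m).hasDerivWithinAt.fun_mul (hh m b)
    have e2 : HasDerivWithinAt (fun s => ∑ m, (G s y)⁻¹ a m * G s y m b) 0 J t :=
      (hasDerivWithinAt_const t J ((1 : Matrix (Fin n) (Fin n) ℝ) a b)).congr_of_mem
        (fun s hs => by
          rw [← Matrix.mul_apply, (hG.isMetricOn hs).inv_mul hy]) ht
    rw [Matrix.add_apply, Matrix.mul_apply, Matrix.mul_apply, ← Finset.sum_add_distrib]
    exact hu.eq_deriv _ e1 e2
  have h2 : D = -((G t y)⁻¹ * h y * (G t y)⁻¹) := by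
    have h3 := congrArg (· * (G t y)⁻¹) h1
    simp only [add_mul, zero_mul] at h3
    rw [mul_assoc, (hG.isMetricOn ht).mul_inv hy, mul_one] at h3
    exact eq_neg_of_add_eq_zero_left h3
  have h4 := (hd i j).hasDerivWithinAt
  rwa [show derivWithin (fun s => (G s y)⁻¹ i j) J t = D i j from rfl, h2] at h4

/-- The variation of a connection is a tensor: differentiating the inverse metric contributes -g^kl
h_lm Γ^m_ij, which is precisely what completes the partial derivatives of h to covariant ones. -/
theorem hasDerivWithinAt_christoffel (hG : IsMetricFamilyOn G J U) (ht : t ∈ J)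
    (hh : ∀ z ∈ U, ∀ i j, HasDerivWithinAt (fun s => G s z i j) (h z i j) J t)
    (hsymm : ∀ z ∈ U, (h z)ᵀ = h z) (hy : y ∈ U) (k i j : Fin n) :
    HasDerivWithinAt (fun s => christoffel (G s) k i j y) (varGam (G t) h i y k j) J t := by
  have hM := hG.isMetricOn ht
  have hp : ∀ c a b, HasDerivWithinAt (fun s => pd c (fun z => G s z a b) y)
      (pd c (fun z => h z a b) y) J t := fun c a b =>
    hasDerivWithinAt_pd hG.ordConnected hG.nontrivial hG.isOpen (f := fun s z => G s z a b)
      (hG.smooth a b) ht (fun z hz => hh z hz a b) hy c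
  have hi := hG.hasDerivWithinAt_inv ht hy (hh y hy)
  have key : HasDerivWithinAt (fun s => christoffel (G s) k i j y)
      ((1 / 2) * ∑ l, ((-((G t y)⁻¹ * h y * (G t y)⁻¹) k l)
          * (pd i (fun z => G t z j l) y + pd j (fun z => G t z i l) y
            - pd l (fun z => G t z i j) y)
        + (G t y)⁻¹ k l * (pd i (fun z => h z j l) y + pd j (fun z => h z i l) y
            - pd l (fun z => h z i j) y))) J t :=
    (HasDerivWithinAt.fun_sum fun l _ =>
      (hi k l).fun_mul (((hp i j l).fun_add (hp j i l)).fun_sub (hp l i j))).const_mul (1 / 2)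
  convert key using 1
  have e1 : ∀ c, ∑ l, (G t y)⁻¹ c l * (pd i (fun z => G t z j l) y + pd j (fun z => G t z i l) y
            - pd l (fun z => G t z i j) y) = 2 * christoffel (G t) c i j y := by
    intro c
    rw [christoffel]; ring
  have e2 : ∑ l, ((G t y)⁻¹ * h y * (G t y)⁻¹) k l
      * (pd i (fun z => G t z j l) y + pd j (fun z => G t z i l) y - pd l (fun z => G t z i j) y)
      = ∑ l, (G t y)⁻¹ k l * ∑ m, h y l m * (2 * christoffel (G t) m i j y) := by
    simp only [← e1]
    rw [show ∀ v : Fin n → ℝ, (∑ l, ((G t y)⁻¹ * h y * (G t y)⁻¹) k l * v l)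
      = (((G t y)⁻¹ * h y * (G t y)⁻¹) *ᵥ v) k from fun _ => rfl, ← Matrix.mulVec_mulVec,
      ← Matrix.mulVec_mulVec]
    rfl
  rw [Finset.sum_add_distrib]
  simp only [neg_mul]
  rw [Finset.sum_neg_distrib, e2, ← sub_eq_neg_add, ← Finset.sum_sub_distrib, Finset.mul_sum,
    varGam, Matrix.mul_apply]
  refine Finset.sum_congr rfl fun l _ => ?_
  have hs : ∀ a b, h y a b = h y b a := fun a b => congrFun (congrFun (hsymm y hy) b) a
  simp only [Matrix.transpose_apply, varGamLow, nab2, Finset.sum_add_distrib, mul_left_comm _ (2:ℝ),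
    ← Finset.mul_sum, hM.christoffel_comm hy _ j i, hM.christoffel_comm hy _ l _]
  simp only [hs _ l, hs _ j, mul_comm (h y _ _)]
  ring

end IsMetricFamilyOn

open Matrix

namespace IsMetricOn

variable {U : Set (EuclideanSpace ℝ (Fin n))}
  {G h : EuclideanSpace ℝ (Fin n) → Matrix (Fin n) (Fin n) ℝ} {y : EuclideanSpace ℝ (Fin n)}

theorem smooth_varGamLow (hG : IsMetricOn G U) (hh : SmoothMat U h) (i : Fin n) :
    SmoothMat U (varGamLow G h i) := fun j l =>
  contDiffOn_const.mul (((hG.smooth_nab2 hh i j l).add (hG.smooth_nab2 hh j i l)).sub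
    (hG.smooth_nab2 hh l i j))

theorem smooth_varGam (hG : IsMetricOn G U) (hh : SmoothMat U h) (i : Fin n) :
    SmoothMat U (varGam G h i) :=
  hG.smooth_inv.mul (hG.smooth_varGamLow hh i).transpose

theorem transpose_varGam_mul (hG : IsMetricOn G U) (hy : y ∈ U) (i : Fin n) :
    (varGam G h i y)ᵀ * G y = varGamLow G h i y := by
  rw [varGam, Matrix.transpose_mul, Matrix.transpose_transpose, hG.inv_symm hy, mul_assoc,
    hG.inv_mul hy, mul_one]

/-- Here i is only a label for the derivative in direction j, hence the uncompensated Christoffel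
term. It is symmetric in i and j and disappears on antisymmetrising in `transpose_varCurv_mul`. -/
theorem nab2_varGamLow (hG : IsMetricOn G U) (hy : y ∈ U) (hh : SmoothMat U h)
    (j i k l : Fin n) :
    nab2 G j (varGamLow G h i) y k l
      = (1 / 2) * (hess2 G h y j i k l + hess2 G h y j k i l - hess2 G h y j l i k)
        + ∑ m, christoffel G m j i y * varGamLow G h m y k l := by
  have hd := fun c a b => (hG.smooth_nab2 hh c).differentiableAt hG.isOpen hy a b
  have e : pd j (fun z => varGamLow G h i z k l) y
      = (1 / 2) * (pd j (fun z => nab2 G i h z k l) y + pd j (fun z => nab2 G k h z i l) y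
        - pd j (fun z => nab2 G l h z i k) y) := by
    simp only [varGamLow]
    rw [pd_const_mul, pd_sub, pd_add]
    all_goals fun_prop (disch := exact hd _ _ _)
  rw [nab2, e]
  have e3 : ∀ q a b, nab2 G j (nab2 G q h) y a b = pd j (fun z => nab2 G q h z a b) y
    - ∑ m, (christoffel G m j a y * nab2 G q h y m b + christoffel G m j b y * nab2 G q h y a m) :=
    fun _ _ _ => rfl
  simp only [hess2, e3]
  simp only [varGamLow, Finset.sum_add_distrib, mul_add, mul_sub, Finset.sum_sub_distrib,
    mul_left_comm _ ((1 : ℝ) / 2), ← Finset.mul_sum]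
  ring

/-- The commutator of covariant derivatives in the variation of the curvature. -/
theorem transpose_varCurv_mul (hG : IsMetricOn G U) (hy : y ∈ U) (hh : SmoothMat U h)
    (i j k l : Fin n) :
    ((pdM j (varGam G h i) y - pdM i (varGam G h j) y
        + (varGam G h j y * gam G i y + gam G j y * varGam G h i y)
        - (varGam G h i y * gam G j y + gam G i y * varGam G h j y))ᵀ * G y) k l
      = (1 / 2) * (hess2 G h y j i k l + hess2 G h y j k i l - hess2 G h y j l i k
        - hess2 G h y i j k l - hess2 G h y i k j l + hess2 G h y i l j k) := by
  have e : ∀ j i, (pdM j (varGam G h i) y + gam G j y * varGam G h i y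
      - varGam G h i y * gam G j y)ᵀ * G y = nab2 G j (varGamLow G h i) y := by
    intro j i
    rw [← hG.pdM_transpose_mul_metric hy (hG.smooth_varGam hh i),
      pdM_congr hG.isOpen hy j fun z hz => hG.transpose_varGam_mul hz i,
      hG.transpose_varGam_mul hy, nab2_eq]
  have e2 : (pdM j (varGam G h i) y - pdM i (varGam G h j) y
        + (varGam G h j y * gam G i y + gam G j y * varGam G h i y)
        - (varGam G h i y * gam G j y + gam G i y * varGam G h j y))ᵀ * G y
      = nab2 G j (varGamLow G h i) y - nab2 G i (varGamLow G h j) y := by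
    rw [← e, ← e, ← sub_mul, ← Matrix.transpose_sub]
    congr 2
    abel
  rw [e2, Matrix.sub_apply, hG.nab2_varGamLow hy hh, hG.nab2_varGamLow hy hh]
  simp only [hG.christoffel_comm hy _ j i]
  ring

end IsMetricOn

/-- The variation of the Riemann tensor `R_ijkl` when the metric varies by `h`. -/
def varRiem (G h : EuclideanSpace ℝ (Fin n) → Matrix (Fin n) (Fin n) ℝ)
    (y : EuclideanSpace ℝ (Fin n)) (i j k l : Fin n) : ℝ :=
  ctr (G y)⁻¹ (fun p q => h y l p * riem G y i j k q)
    + (1 / 2) * (hess2 G h y j i k l + hess2 G h y j k i l - hess2 G h y j l i k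
        - hess2 G h y i j k l - hess2 G h y i k j l + hess2 G h y i l j k)

namespace IsMetricFamilyOn

variable {J : Set ℝ} {U : Set (EuclideanSpace ℝ (Fin n))}
  {G : ℝ → EuclideanSpace ℝ (Fin n) → Matrix (Fin n) (Fin n) ℝ}
  {h : EuclideanSpace ℝ (Fin n) → Matrix (Fin n) (Fin n) ℝ}
  {t : ℝ} {y : EuclideanSpace ℝ (Fin n)}

theorem hasDerivWithinAt_riemUp (hG : IsMetricFamilyOn G J U) (ht : t ∈ J)
    (hh : ∀ z ∈ U, ∀ i j, HasDerivWithinAt (fun s => G s z i j) (h z i j) J t)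
    (hsymm : ∀ z ∈ U, (h z)ᵀ = h z) (hy : y ∈ U) (l i j k : Fin n) :
    HasDerivWithinAt (fun s => riemUp (G s) y l i j k)
      ((pdM j (varGam (G t) h i) y - pdM i (varGam (G t) h j) y
        + (varGam (G t) h j y * gam (G t) i y + gam (G t) j y * varGam (G t) h i y)
        - (varGam (G t) h i y * gam (G t) j y + gam (G t) i y * varGam (G t) h j y)) l k) J t := by
  have hc := fun z hz => hG.hasDerivWithinAt_christoffel ht hh hsymm (y := z) hz
  have hp : ∀ c a b d, HasDerivWithinAt (fun s => pd c (christoffel (G s) a b d) y)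
      (pd c (fun z => varGam (G t) h b z a d) y) J t := fun c a b d =>
    hasDerivWithinAt_pd hG.ordConnected hG.nontrivial hG.isOpen
      (f := fun s => christoffel (G s) a b d) (hG.smooth_christoffel a b d) ht
      (fun z hz => hc z hz a b d) hy c
  have key := ((hp j l i k).fun_sub (hp i l j k)).fun_add (HasDerivWithinAt.fun_sum
    (u := Finset.univ) fun m _ => ((hc y hy m i k).fun_mul (hc y hy l j m)).fun_sub
      ((hc y hy m j k).fun_mul (hc y hy l i m)))
  refine key.congr_deriv ?_
  simp only [Matrix.add_apply, Matrix.sub_apply, Matrix.mul_apply, pdM, gam,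
    ← Finset.sum_add_distrib]
  rw [add_sub_assoc, ← Finset.sum_sub_distrib]
  congr 1
  exact Finset.sum_congr rfl fun m _ => by ring

theorem hasDerivWithinAt_riem (hG : IsMetricFamilyOn G J U) (ht : t ∈ J)
    (hh : ∀ z ∈ U, ∀ i j, HasDerivWithinAt (fun s => G s z i j) (h z i j) J t)
    (hsymm : ∀ z ∈ U, (h z)ᵀ = h z) (hsm : SmoothMat U h) (hy : y ∈ U) (i j k l : Fin n) :
    HasDerivWithinAt (fun s => riem (G s) y i j k l) (varRiem (G t) h y i j k l) J t := by
  have hM := hG.isMetricOn ht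
  have key := HasDerivWithinAt.fun_sum (u := Finset.univ) fun m _ =>
    (hh y hy l m).fun_mul (hG.hasDerivWithinAt_riemUp ht hh hsymm hy m i j k)
  refine key.congr_deriv ?_
  have e1 : ∑ m, h y l m * riemUp (G t) y m i j k
      = ctr (G t y)⁻¹ (fun p q => h y l p * riem (G t) y i j k q) := by
    refine Finset.sum_congr rfl fun m _ => ?_
    have e : curv (G t) i j y = (G t y)⁻¹ * (G t y * curv (G t) i j y) := by
      rw [← mul_assoc, hM.inv_mul hy, one_mul]
    have e' : riemUp (G t) y m i j k = ∑ q, (G t y)⁻¹ m q * riem (G t) y i j k q :=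
      congrFun (congrFun e m) k
    rw [e', Finset.mul_sum]
    exact Finset.sum_congr rfl fun _ _ => by ring
  rw [Finset.sum_add_distrib, e1, varRiem, ← hM.transpose_varCurv_mul hy hsm, Matrix.mul_apply]
  congr 1
  refine Finset.sum_congr rfl fun m _ => ?_
  rw [hM.apply_comm hy l m, mul_comm, Matrix.transpose_apply]

theorem hasDerivWithinAt_ctr (hG : IsMetricFamilyOn G J U) (ht : t ∈ J) (hy : y ∈ U)
    (hh : ∀ i j, HasDerivWithinAt (fun s => G s y i j) (h y i j) J t)
    {X : ℝ → Fin n → Fin n → ℝ} {X' : Fin n → Fin n → ℝ}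
    (hX : ∀ i j, HasDerivWithinAt (fun s => X s i j) (X' i j) J t) :
    HasDerivWithinAt (fun s => ctr (G s y)⁻¹ (X s))
      (ctr (G t y)⁻¹ X' - ctr ((G t y)⁻¹ * h y * (G t y)⁻¹) (X t)) J t := by
  have key := HasDerivWithinAt.fun_sum (u := Finset.univ) fun p _ =>
    HasDerivWithinAt.fun_sum (u := Finset.univ) fun q _ =>
      (hG.hasDerivWithinAt_inv ht hy hh p q).fun_mul (hX p q)
  refine key.congr_deriv ?_
  simp only [ctr, Finset.sum_add_distrib, neg_mul, Finset.sum_neg_distrib]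
  ring

end IsMetricFamilyOn

/-! ### Algebra of curvature tensors at a point -/

/-- `B` is the inverse of the symmetric matrix `g`. -/
structure IsInverseMetric (g B : Matrix (Fin n) (Fin n) ℝ) : Prop where
  symm : g.transpose = g
  inv_symm : B.transpose = B
  mul_inv : g * B = 1

/-- The algebraic symmetries of the Riemann tensor. -/
structure IsAlgebraicCurvature (R : Fin n → Fin n → Fin n → Fin n → ℝ) : Prop where
  left : ∀ i j k l, R i j k l = -R j i k l
  right : ∀ i j k l, R i j k l = -R i j l k
  pair : ∀ i j k l, R i j k l = R k l i j
  bianchi : ∀ i j k l, R i j k l + R j k i l + R k i j l = 0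

/-- `g^pq g^rs T_ipjr T'_kqls`. -/
def quadB (B : Matrix (Fin n) (Fin n) ℝ) (T T' : Fin n → Fin n → Fin n → Fin n → ℝ)
    (i j k l : Fin n) : ℝ :=
  ctr B fun p q => ctr B fun r s => T i p j r * T' k q l s

/-- `g^pq (R_pjkl P_qi + R_ipkl P_qj + R_ijpl P_qk + R_ijkp P_ql)`. -/
def ricAct (B : Matrix (Fin n) (Fin n) ℝ) (R : Fin n → Fin n → Fin n → Fin n → ℝ)
    (P : Matrix (Fin n) (Fin n) ℝ) (i j k l : Fin n) : ℝ :=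
  ctr B fun p q => R p j k l * P q i + R i p k l * P q j + R i j p l * P q k + R i j k p * P q l

/-- `g^pq g^rs R_ipkr P_qs`. -/
def curvAct (B : Matrix (Fin n) (Fin n) ℝ) (R : Fin n → Fin n → Fin n → Fin n → ℝ)
    (P : Matrix (Fin n) (Fin n) ℝ) : Matrix (Fin n) (Fin n) ℝ :=
  fun i k => ctr B fun p q => ctr B fun r s => R i p k r * P q s

/-- `g^pq P_ap Q_bq`. -/
def prodC (B P Q : Matrix (Fin n) (Fin n) ℝ) : Matrix (Fin n) (Fin n) ℝ :=
  fun a b => ctr B fun p q => P a p * Q b q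

/-- B h B is h with both indices raised; it enters through the derivative of the inverse metric. -/
theorem ctr_sandwich {B : Matrix (Fin n) (Fin n) ℝ} (hB : B.transpose = B)
    (h : Matrix (Fin n) (Fin n) ℝ) (X : Fin n → Fin n → ℝ) :
    ctr (B * h * B) X = ctr B fun p q => ctr B fun r s => h q s * X p r := by
  have hB' : ∀ a b, B a b = B b a := fun a b => congrFun (congrFun hB b) a
  simp only [ctr, Matrix.mul_apply, Finset.sum_mul, Finset.mul_sum]
  refine Finset.sum_congr rfl fun p _ => ?_
  rw [Finset.sum_congr rfl fun r _ => Finset.sum_comm, Finset.sum_comm]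
  refine Finset.sum_congr rfl fun q _ => Finset.sum_congr rfl fun r _ =>
    Finset.sum_congr rfl fun s _ => ?_
  rw [hB' r s]
  ring

namespace IsInverseMetric

variable {g B : Matrix (Fin n) (Fin n) ℝ}

theorem apply_comm (hg : IsInverseMetric g B) (i j : Fin n) : g i j = g j i :=
  congrFun (congrFun hg.symm j) i

theorem inv_mul (hg : IsInverseMetric g B) : B * g = 1 := mul_eq_one_comm.1 hg.mul_inv

theorem ctr_metric_mul (hg : IsInverseMetric g B) (a : Fin n) (X : Fin n → ℝ) :
    ctr B (fun p q => g a p * X q) = X a := by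
  have h : ∀ q, ∑ p, B p q * (g a p * X q) = (1 : Matrix (Fin n) (Fin n) ℝ) a q * X q := by
    intro q
    rw [← hg.mul_inv, Matrix.mul_apply, Finset.sum_mul]
    exact Finset.sum_congr rfl fun p _ => by ring
  rw [ctr, Finset.sum_comm, Finset.sum_congr rfl fun q _ => h q]
  simp [Matrix.one_apply]

theorem ctr_mul_metric (hg : IsInverseMetric g B) (a : Fin n) (X : Fin n → ℝ) :
    ctr B (fun p q => X p * g a q) = X a := by
  rw [← hg.ctr_metric_mul a X, ← ctr_swap hg.inv_symm]
  exact ctr_congr fun p q => mul_comm _ _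

theorem ctr_metric (hg : IsInverseMetric g B) : ctr B g = n := by
  have h : ctr B g = (B * g).trace := by
    simp only [ctr, Matrix.trace, Matrix.diag, Matrix.mul_apply]
    exact Finset.sum_congr rfl fun p _ => Finset.sum_congr rfl fun q _ => by
      rw [hg.apply_comm]
  rw [h, hg.inv_mul, Matrix.trace_one, Fintype.card_fin]

theorem ctr_swap (hg : IsInverseMetric g B) (X : Fin n → Fin n → ℝ) :
    ctr B (fun p q => X q p) = ctr B X := RBFlow.ctr_swap hg.inv_symm X

end IsInverseMetric

namespace IsAlgebraicCurvature

variable {g B : Matrix (Fin n) (Fin n) ℝ} {R : Fin n → Fin n → Fin n → Fin n → ℝ}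

theorem contr_symm (hR : IsAlgebraicCurvature R) (hg : IsInverseMetric g B) (i k : Fin n) :
    contr B R i k = contr B R k i := by
  rw [contr_apply, contr_apply, ← hg.ctr_swap]
  exact ctr_congr fun p q => hR.pair _ _ _ _

theorem quadB_pair (B : Matrix (Fin n) (Fin n) ℝ) (hB : B.transpose = B)
    (T T' : Fin n → Fin n → Fin n → Fin n → ℝ) (i j k l : Fin n) :
    quadB B T T' i j k l = quadB B T' T k l i j := by
  rw [quadB, quadB, ← ctr_swap hB]
  refine ctr_congr fun p q => ?_
  rw [← ctr_swap hB]
  exact ctr_congr fun r s => mul_comm _ _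

theorem quadB_swap (hR : IsAlgebraicCurvature R) (i j k l : Fin n) :
    quadB B R R j i k l = quadB B R R i j l k := by
  rw [quadB, quadB, ctr_comm]
  exact ctr_congr fun p q => ctr_congr fun r s => by rw [hR.pair j r, hR.pair k s]

/-- The quadratic terms in the commutation of a divergence with a covariant derivative. -/
theorem ctr_commutator (hR : IsAlgebraicCurvature R) (hg : IsInverseMetric g B)
    (i j k l : Fin n) :
    ctr B (fun p q => ctr B fun s r => R p i j r * R s q k l + R p i q r * R j s k l
        + R p i k r * R j q s l + R p i l r * R j q k s)
      = quadB B R R i j k l - quadB B R R i j l k + ctr B (fun s r => contr B R i r * R j s k l)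
        + quadB B R R i k j l - quadB B R R i l j k := by
  have a1 : ctr B (fun p q => ctr B fun s r => R p i j r * R s q k l)
      = quadB B R R i j k l - quadB B R R i j l k := by
    rw [quadB, quadB, ← ctr_sub]
    refine ctr_congr fun p q => ?_
    rw [← ctr_sub, ← hg.ctr_swap]
    refine ctr_congr fun r s => ?_
    -- The first Bianchi identity splits R_sqkl into the two factors that produce B_ijkl and B_ijlk.
    have b := hR.bianchi k l s q
    rw [hR.pair l s k q, hR.left s k l q, hR.pair k s l q] at b
    rw [hR.pair s q k l, hR.left p i]
    linear_combination (-R i p j r) * b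
  have a2 : ctr B (fun p q => ctr B fun s r => R p i q r * R j s k l)
      = ctr B (fun s r => contr B R i r * R j s k l) := by
    rw [ctr_comm]
    refine ctr_congr fun s r => ?_
    rw [ctr_mul_right, contr_apply]
    congr 1
    exact ctr_congr fun p q => by rw [hR.left, hR.right]; ring
  have a3 : ctr B (fun p q => ctr B fun s r => R p i k r * R j q s l) = quadB B R R i k j l := by
    refine ctr_congr fun p q => ?_
    rw [← hg.ctr_swap]
    exact ctr_congr fun r s => by rw [hR.left p i, hR.right j q s l]; ring
  have a4 : ctr B (fun p q => ctr B fun s r => R p i l r * R j q k s)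
      = -quadB B R R i l j k := by
    rw [quadB, ← ctr_neg]
    refine ctr_congr fun p q => ?_
    rw [← ctr_neg, ← hg.ctr_swap]
    exact ctr_congr fun r s => by rw [hR.left p i]; ring
  simp only [ctr_add]
  rw [a1, a2, a3, a4]
  ring

/-- The contracted quadratic terms of the reaction part. -/
theorem ctr_quadB (hR : IsAlgebraicCurvature R) (hg : IsInverseMetric g B) (i k : Fin n) :
    ctr B (fun j l => quadB B R R i j k l - quadB B R R i j l k - quadB B R R i l j k
        + quadB B R R i k j l) = curvAct B R (contr B R) i k := by
  have h4 : ctr B (fun j l => quadB B R R i k j l) = curvAct B R (contr B R) i k := by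
    simp only [quadB]
    rw [ctr_comm]
    refine ctr_congr fun p q => ?_
    rw [ctr_comm]
    refine ctr_congr fun r s => ?_
    rw [ctr_mul_left, contr_apply]
    congr 1
    exact ctr_congr fun j l => by rw [hR.left j q, hR.right q j]; ring
  have h3 : ctr B (fun j l => quadB B R R i l j k) = ctr B (fun j l => quadB B R R i j l k) :=
    hg.ctr_swap fun j l => quadB B R R i j l k
  -- Relabelling the contracted pairs, so that (j, l) and (r, s) trade places, brings this trace to
  -- the form met again in `h1`.
  have h2 : ctr B (fun j l => quadB B R R i j l k)
      = -ctr B (fun j l => ctr B fun p q => ctr B fun r s => R i p j r * R k l s q) := by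
    have e : ∀ X : Fin n → Fin n → Fin n → Fin n → Fin n → Fin n → ℝ,
        ctr B (fun j l => ctr B fun p q => ctr B fun r s => X j l p q r s)
          = ctr B (fun j l => ctr B fun p q => ctr B fun r s => X r s p q j l) := by
      intro X
      rw [ctr_comm, ctr_comm B B fun j l p q => ctr B fun r s => X r s p q j l]
      exact ctr_congr fun p q => ctr_comm B B fun j l r s => X j l p q r s
    rw [e, ← ctr_neg]
    refine ctr_congr fun j l => ?_
    rw [quadB, ← ctr_neg]
    refine ctr_congr fun p q => ?_
    rw [← ctr_neg]
    exact ctr_congr fun r s => by rw [hR.right i p j r, hR.pair l q k s]; ring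
  -- Hamilton's identity g^jl (B_ijkl - 2 B_ijlk) = 0. By the first Bianchi identity the difference
  -- B_ijkl - B_ijlk has the trace found in `h2`. Three of the four traces then cancel.
  have h1 : ctr B (fun j l => quadB B R R i j k l)
      = 2 * ctr B (fun j l => quadB B R R i j l k) := by
    have e : ctr B (fun j l => quadB B R R i j k l) = ctr B (fun j l => quadB B R R i j l k)
        - ctr B (fun j l => ctr B fun p q => ctr B fun r s => R i p j r * R k l s q) := by
      rw [← ctr_sub]
      refine ctr_congr fun j l => ?_
      rw [quadB, quadB, ← ctr_sub]
      refine ctr_congr fun p q => ?_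
      rw [← ctr_sub]
      refine ctr_congr fun r s => ?_
      have b := hR.bianchi k s l q
      rw [hR.pair s l, hR.right k q s l, hR.left l k] at b
      rw [hR.pair l q k s]
      linear_combination (-R i p j r) * b
    linarith
  simp only [ctr_add, ctr_sub]
  rw [h1, h3, h4]
  ring

/-- Ric acting on a free slot leaves a trace of Riem and gives Ric²; acting on a contracted slot it
gives the curvature operator applied to Ric. -/
theorem ctr_ricAct (hR : IsAlgebraicCurvature R) (hg : IsInverseMetric g B) (i k : Fin n) :
    ctr B (fun j l => ricAct B R (contr B R) i j k l)
      = 2 * prodC B (contr B R) (contr B R) i k + 2 * curvAct B R (contr B R) i k := by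
  have hs := hR.contr_symm hg
  have e1 : ctr B (fun j l => ctr B fun p q => R p j k l * contr B R q i)
      = prodC B (contr B R) (contr B R) i k := by
    rw [ctr_comm, prodC, ← hg.ctr_swap]
    refine ctr_congr fun p q => ?_
    rw [ctr_mul_right, ← contr_apply, hs i, hs k, mul_comm]
  have e2 : ctr B (fun j l => ctr B fun p q => R i p k l * contr B R q j)
      = curvAct B R (contr B R) i k := by
    rw [ctr_comm]
    refine ctr_congr fun p q => ?_
    rw [← hg.ctr_swap]
  have e3 : ctr B (fun j l => ctr B fun p q => R i j p l * contr B R q k)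
      = prodC B (contr B R) (contr B R) i k := by
    rw [ctr_comm]
    refine ctr_congr fun p q => ?_
    rw [ctr_mul_right, ← contr_apply, hs k]
  have e4 : ctr B (fun j l => ctr B fun p q => R i j k p * contr B R q l)
      = curvAct B R (contr B R) i k :=
    ctr_congr fun p q => ctr_congr fun r s => by rw [hs s]
  simp only [ricAct, ctr_add]
  rw [e1, e2, e3, e4]
  ring

theorem ctr_curvAct (hR : IsAlgebraicCurvature R) :
    ctr B (curvAct B R (contr B R))
      = ctr B fun p q => ctr B fun r s => contr B R p r * contr B R q s := by
  have e : ctr B (fun i k => ctr B fun p q => ctr B fun r s => R i p k r * contr B R q s)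
      = ctr B fun p q => ctr B fun r s => contr B R p r * contr B R q s := by
    rw [ctr_comm]
    refine ctr_congr fun p q => ?_
    rw [ctr_comm]
    refine ctr_congr fun r s => ?_
    rw [ctr_mul_right, contr_apply]
    congr 1
    exact ctr_congr fun i k => by rw [hR.left, hR.right]; ring
  exact e

end IsAlgebraicCurvature

/-! ### Second derivatives of the curvature and Hamilton's formula for its Laplacian -/

/-- The algebraic properties of `D_pqijkl = ∇_p ∇_q R_ijkl`. -/
structure IsSecondDerivative (B : Matrix (Fin n) (Fin n) ℝ)
    (R : Fin n → Fin n → Fin n → Fin n → ℝ)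
    (D : Fin n → Fin n → Fin n → Fin n → Fin n → Fin n → ℝ) : Prop where
  left : ∀ p q i j k l, D p q i j k l = -D p q j i k l
  right : ∀ p q i j k l, D p q i j k l = -D p q i j l k
  pair : ∀ p q i j k l, D p q i j k l = D p q k l i j
  bianchi : ∀ p q i j k l, D p q i j k l + D p i j q k l + D p j q i k l = 0
  comm : ∀ p q i j k l, D p q i j k l - D q p i j k l
    = ctr B fun s r => R p q i r * R s j k l + R p q j r * R i s k l + R p q k r * R i j s l
        + R p q l r * R i j k s

namespace IsSecondDerivative

variable {g B : Matrix (Fin n) (Fin n) ℝ} {R : Fin n → Fin n → Fin n → Fin n → ℝ}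
  {D : Fin n → Fin n → Fin n → Fin n → Fin n → Fin n → ℝ}

theorem contr_symm (hD : IsSecondDerivative B R D) (hg : IsInverseMetric g B)
    (a b i k : Fin n) : contr B (D a b) i k = contr B (D a b) k i := by
  rw [contr_apply, contr_apply, ← hg.ctr_swap]
  exact ctr_congr fun p q => hD.pair _ _ _ _ _ _

/-- The Ricci identity for Ric, by tracing the one for Riem: the two terms in which the curvature
acts on the contracted indices cancel (`e3`). -/
theorem contr_comm (hR : IsAlgebraicCurvature R) (hD : IsSecondDerivative B R D)
    (hg : IsInverseMetric g B) (i j k l : Fin n) :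
    contr B (D i j) k l - contr B (D j i) k l
      = ctr B (fun s r => R i j k r * contr B R s l)
        + ctr B (fun s r => R i j l r * contr B R k s) := by
  have e1 : ctr B (fun a b => ctr B fun s r => R i j k r * R s a l b)
      = ctr B (fun s r => R i j k r * contr B R s l) := by
    rw [ctr_comm]
    exact ctr_congr fun p q => by rw [ctr_mul_left, contr_apply]
  have e2 : ctr B (fun a b => ctr B fun s r => R i j l r * R k a s b)
      = ctr B (fun s r => R i j l r * contr B R k s) := by
    rw [ctr_comm]
    exact ctr_congr fun p q => by rw [ctr_mul_left, contr_apply]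
  have e3 : ctr B (fun a b => ctr B fun s r => R i j b r * R k a l s)
      = -ctr B (fun a b => ctr B fun s r => R i j a r * R k s l b) := by
    rw [ctr_comm, ← hg.ctr_swap, ← ctr_neg]
    refine ctr_congr fun a b => ?_
    rw [← ctr_neg]
    exact ctr_congr fun s r => by rw [hR.right i j r a]; ring
  rw [contr_apply, contr_apply, ← ctr_sub]
  rw [ctr_congr fun a b => hD.comm i j k a l b]
  simp only [ctr_add]
  rw [e1, e2, e3]
  ring

/-- Bianchi turns ∇^p∇_p R_ijkl into derivatives ∇^p∇_i and ∇^p∇_j of Riem (`h1`); commuting them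
costs quadratic terms (`h2`); the divergence now inside is, by the contracted Bianchi identity on
the other index pair, a difference of derivatives of Ric (`h3`). -/
theorem ctr_eq (hR : IsAlgebraicCurvature R) (hD : IsSecondDerivative B R D)
    (hg : IsInverseMetric g B) (i j k l : Fin n) :
    ctr B (fun p q => D p q i j k l)
      = contr B (D i k) j l - contr B (D i l) j k - contr B (D j k) i l + contr B (D j l) i k
        + ctr B (fun s r => contr B R j r * R i s k l) - ctr B (fun s r => contr B R i r * R j s k l)
        - 2 * (quadB B R R i j k l - quadB B R R i j l k - quadB B R R i l j k
          + quadB B R R i k j l) := by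
  have hs := hD.contr_symm hg
  have h1 : ctr B (fun p q => D p q i j k l)
      = -ctr B (fun p q => D p i j q k l) + ctr B (fun p q => D p j i q k l) := by
    rw [← ctr_neg, ← ctr_add]
    refine ctr_congr fun p q => ?_
    linear_combination hD.bianchi p q i j k l - hD.left p j q i k l
  have h2 : ∀ i j, ctr B (fun p q => D p i j q k l)
      = ctr B (fun p q => D i p j q k l)
        + (quadB B R R i j k l - quadB B R R i j l k
          + ctr B (fun s r => contr B R i r * R j s k l)
          + quadB B R R i k j l - quadB B R R i l j k) := by
    intro i j
    rw [← hR.ctr_commutator hg, ← ctr_add]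
    refine ctr_congr fun p q => ?_
    rw [← hD.comm p i j q k l]
    ring
  have h3 : ∀ i j, ctr B (fun p q => D i p j q k l)
      = -contr B (D i k) l j + contr B (D i l) k j := by
    intro i j
    rw [contr_apply, contr_apply, ← ctr_neg, ← ctr_add]
    refine ctr_congr fun p q => ?_
    rw [hD.pair i p j q k l]
    linear_combination hD.bianchi i p k l j q - hD.left i l p k j q
  have p1 : quadB B R R j k i l = quadB B R R i l j k :=
    IsAlgebraicCurvature.quadB_pair B hg.inv_symm R R j k i l
  have p2 : quadB B R R j l i k = quadB B R R i k j l :=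
    IsAlgebraicCurvature.quadB_pair B hg.inv_symm R R j l i k
  rw [h1, h2, h2, h3, h3, hR.quadB_swap i j, hR.quadB_swap i j, p1, p2, hs i k l j, hs i l k j,
    hs j k l i, hs j l k i]
  ring

/-- The variation of the curvature tensor along `h = -2 Ric + u g`, where
`∇_p ∇_q h = -2 ∇_p ∇_q Ric + U_pq g`. -/
theorem variation_eq (hR : IsAlgebraicCurvature R) (hD : IsSecondDerivative B R D)
    (hg : IsInverseMetric g B) (u : ℝ) {V : Matrix (Fin n) (Fin n) ℝ}
    (hV : ∀ p q, V p q = V q p) {h : Matrix (Fin n) (Fin n) ℝ}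
    (hh : ∀ i j, h i j = -2 * contr B R i j + u * g i j)
    {H : Fin n → Fin n → Matrix (Fin n) (Fin n) ℝ}
    (hH : ∀ p q i j, H p q i j = -2 * contr B (D p q) i j + V p q * g i j) (i j k l : Fin n) :
    ctr B (fun p q => h l p * R i j k q)
      + (1 / 2) * (H j i k l + H j k i l - H j l i k - H i j k l - H i k j l + H i l j k)
      = ctr B (fun p q => D p q i j k l)
        + 2 * (quadB B R R i j k l - quadB B R R i j l k - quadB B R R i l j k
          + quadB B R R i k j l)
        - ricAct B R (contr B R) i j k l + u * R i j k l
        - (1 / 2) * kulkarniNomizu V g i j k l := by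
  have hs := hR.contr_symm hg
  have e1 : ctr B (fun p q => h l p * R i j k q)
      = -2 * ctr B (fun p q => contr B R l p * R i j k q) + u * R i j k l := by
    simp only [hh, add_mul, ctr_add, mul_assoc, ctr_mul_left]
    rw [hg.ctr_metric_mul l fun q => R i j k q]
  have r1 : ctr B (fun p q => R p j k l * contr B R q i)
      = -ctr B (fun s r => contr B R i r * R j s k l) := by
    rw [← ctr_neg]
    exact ctr_congr fun p q => by rw [hR.left p j, hs q i]; ring
  have r2 : ctr B (fun p q => R i p k l * contr B R q j)
      = ctr B (fun s r => contr B R j r * R i s k l) :=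
    ctr_congr fun p q => by rw [hs q j]; ring
  have r3 : ctr B (fun p q => R i j p l * contr B R q k)
      = -ctr B (fun s r => R i j l r * contr B R k s) := by
    rw [← ctr_neg, ← hg.ctr_swap]
    exact ctr_congr fun p q => by rw [hR.right i j q l, hs p k]; ring
  have r4 : ctr B (fun p q => R i j k p * contr B R q l)
      = ctr B (fun p q => contr B R l p * R i j k q) := by
    rw [← hg.ctr_swap]
    exact ctr_congr fun p q => by rw [hs p l]; ring
  have r5 : ctr B (fun s r => R i j k r * contr B R s l)
      = ctr B (fun p q => contr B R l p * R i j k q) :=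
    ctr_congr fun p q => by rw [hs p l]; ring
  -- Of the six second derivatives of h, four match those in ΔRiem. The other two form the
  -- commutator of derivatives on Ric_kl, which provides the action of Ric on the indices k and l.
  have c := hD.contr_comm hR hg i j k l
  rw [r5] at c
  have hE := hD.contr_symm hg
  simp only [hH]
  rw [hD.ctr_eq hR hg, e1]
  simp only [ricAct, ctr_add, kulkarniNomizu]
  rw [r1, r2, r3, r4, hE j k i l, hE j l i k, hE i k j l, hE i l j k, hV j i, hV j k, hV j l,
    hg.apply_comm j k, hg.apply_comm j l, hE i k l j, hE j l k i, hE j k l i, hE i l k j]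
  linear_combination c

end IsSecondDerivative

/-- `B_ijkl - B_ijlk - B_iljk + B_ikjl`. -/
def reaction (X : Fin n → Fin n → Fin n → Fin n → ℝ) (i j k l : Fin n) : ℝ :=
  X i j k l - X i j l k - X i l j k + X i k j l

/-! ### Kulkarni–Nomizu products with the metric in traces and quadratic terms -/

section KulkarniNomizu

variable {g B A P : Matrix (Fin n) (Fin n) ℝ} {R : Fin n → Fin n → Fin n → Fin n → ℝ}

theorem prodC_comm (hg : IsInverseMetric g B) (A P : Matrix (Fin n) (Fin n) ℝ) (i j : Fin n) :
    prodC B A P i j = prodC B P A j i := by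
  rw [prodC, prodC, ← hg.ctr_swap]
  exact ctr_congr fun p q => mul_comm _ _

/-- Each of the four terms of A ⊙ g contains one g, which collapses a contraction unless both its
indices are free. -/
theorem quadB_kulkarniNomizu (hg : IsInverseMetric g B) (A : Matrix (Fin n) (Fin n) ℝ)
    (T : Fin n → Fin n → Fin n → Fin n → ℝ) (i j k l : Fin n) :
    quadB B T (kulkarniNomizu A g) i j k l
      = contr B T i j * A k l + curvAct B T A i j * g k l
        - ctr B (fun r s => T i l j r * A k s) - ctr B (fun p q => T i p j k * A q l) := by
  have e1 : ctr B (fun p q => ctr B fun r s => T i p j r * (A k l * g q s))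
      = contr B T i j * A k l := by
    rw [contr_apply, ← ctr_mul_right]
    refine ctr_congr fun p q => ?_
    rw [← hg.ctr_mul_metric q fun r => T i p j r * A k l]
    exact ctr_congr fun r s => by ring
  have e2 : ctr B (fun p q => ctr B fun r s => T i p j r * (A q s * g k l))
      = curvAct B T A i j * g k l := by
    rw [curvAct, ← ctr_mul_right]
    refine ctr_congr fun p q => ?_
    rw [← ctr_mul_right]
    exact ctr_congr fun r s => by ring
  have e3 : ctr B (fun p q => ctr B fun r s => T i p j r * (A k s * g q l))
      = ctr B (fun r s => T i l j r * A k s) := by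
    rw [ctr_comm]
    refine ctr_congr fun r s => ?_
    rw [← hg.ctr_mul_metric l fun p => T i p j r * A k s]
    exact ctr_congr fun p q => by rw [hg.apply_comm q l]; ring
  have e4 : ctr B (fun p q => ctr B fun r s => T i p j r * (A q l * g k s))
      = ctr B (fun p q => T i p j k * A q l) := by
    refine ctr_congr fun p q => ?_
    rw [← hg.ctr_mul_metric k fun r => T i p j r * A q l]
    exact ctr_congr fun r s => by ring
  rw [← e1, ← e2, ← e3, ← e4, ← ctr_add, ← ctr_sub, ← ctr_sub]
  refine ctr_congr fun p q => ?_
  rw [← ctr_add, ← ctr_sub, ← ctr_sub]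
  exact ctr_congr fun r s => by rw [kulkarniNomizu]; ring

theorem contr_kulkarniNomizu (hg : IsInverseMetric g B) (A : Matrix (Fin n) (Fin n) ℝ)
    (i k : Fin n) :
    contr B (kulkarniNomizu A g) i k = ((n : ℝ) - 2) * A i k + ctr B A * g i k := by
  have e1 : ctr B (fun p q => A i q * g p k) = A i k := by
    rw [← hg.ctr_metric_mul k (A i)]
    exact ctr_congr fun p q => by rw [hg.apply_comm p]; ring
  have e2 : ctr B (fun p q => A p k * g i q) = A i k := by
    rw [← hg.ctr_mul_metric i fun p => A p k]
  have e3 : ctr B (fun p q => A i k * g p q) = A i k * n := by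
    rw [← hg.ctr_metric]
    exact ctr_mul_left B _ g
  have e4 : ctr B (fun p q => A p q * g i k) = ctr B A * g i k := ctr_mul_right B _ A
  rw [contr_apply]
  simp only [kulkarniNomizu, ctr_add, ctr_sub]
  rw [e1, e2, e3, e4]
  ring

theorem ctr_kulkarniNomizu_mul (hg : IsInverseMetric g B) (A P : Matrix (Fin n) (Fin n) ℝ)
    (i j l k : Fin n) :
    ctr B (fun r s => kulkarniNomizu A g i l j r * P k s)
      = A i j * P k l + prodC B A P l k * g i j - prodC B A P i k * g l j - A l j * P k i := by
  have e1 : ctr B (fun r s => A i j * g l r * P k s) = A i j * P k l := by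
    rw [← hg.ctr_metric_mul l (P k), ← ctr_mul_left]
    exact ctr_congr fun r s => by ring
  have e2 : ctr B (fun r s => A l r * g i j * P k s) = prodC B A P l k * g i j := by
    rw [prodC, ← ctr_mul_right]
    exact ctr_congr fun r s => by ring
  have e3 : ctr B (fun r s => A i r * g l j * P k s) = prodC B A P i k * g l j := by
    rw [prodC, ← ctr_mul_right]
    exact ctr_congr fun r s => by ring
  have e4 : ctr B (fun r s => A l j * g i r * P k s) = A l j * P k i := by
    rw [← hg.ctr_metric_mul i (P k), ← ctr_mul_left]
    exact ctr_congr fun r s => by ring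
  rw [← e1, ← e2, ← e3, ← e4, ← ctr_add, ← ctr_sub, ← ctr_sub]
  exact ctr_congr fun r s => by rw [kulkarniNomizu]; ring

theorem kulkarniNomizu_pair (hg : IsInverseMetric g B) (hA : ∀ i j, A i j = A j i)
    (i j k l : Fin n) : kulkarniNomizu A g i j k l = kulkarniNomizu A g k l i j := by
  simp only [kulkarniNomizu]
  rw [hA k i, hA l j, hA k j, hA l i, hg.apply_comm l j, hg.apply_comm k i, hg.apply_comm l i,
    hg.apply_comm k j]
  ring

theorem kulkarniNomizu_right (A P : Matrix (Fin n) (Fin n) ℝ) (i j k l : Fin n) :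
    kulkarniNomizu A P i j k l = -kulkarniNomizu A P i j l k := by
  simp only [kulkarniNomizu]; ring

theorem curvAct_kulkarniNomizu (hg : IsInverseMetric g B) (hA : ∀ i j, A i j = A j i)
    (i j : Fin n) :
    curvAct B (kulkarniNomizu A g) A i j
      = ctr B A * A i j + ctr B (prodC B A A) * g i j - 2 * prodC B A A i j := by
  have h1 : curvAct B (kulkarniNomizu A g) A i j
      = ctr B fun p q => A i j * A q p + prodC B A A p q * g i j - prodC B A A i q * g p j
        - A p j * A q i :=
    ctr_congr fun p q => ctr_kulkarniNomizu_mul hg A A i j p q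
  have h2 : ctr B (fun p q => prodC B A A i q * g p j) = prodC B A A i j := by
    rw [← hg.ctr_metric_mul j (prodC B A A i)]
    exact ctr_congr fun p q => by rw [hg.apply_comm p]; ring
  have h3 : ctr B (fun p q => A p j * A q i) = prodC B A A i j := by
    rw [prodC, ← hg.ctr_swap]
    exact ctr_congr fun p q => by rw [hA q j, hA p i]; ring
  have h4 : ctr B (fun p q => A q p) = ctr B A := hg.ctr_swap A
  have h5 : ctr B (fun p q => prodC B A A p q * g i j) = ctr B (prodC B A A) * g i j :=
    ctr_mul_right B _ (prodC B A A)
  rw [h1]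
  simp only [ctr_add, ctr_sub, ctr_mul_left]
  rw [h2, h3, h4, h5]
  ring

theorem quadB_kulkarniNomizu_self (hg : IsInverseMetric g B) (hA : ∀ i j, A i j = A j i)
    (i j k l : Fin n) :
    quadB B (kulkarniNomizu A g) (kulkarniNomizu A g) i j k l
      = ((n : ℝ) - 4) * (A i j * A k l) + ctr B A * (A k l * g i j + A i j * g k l)
        + ctr B (prodC B A A) * (g i j * g k l)
        - 2 * (prodC B A A i j * g k l + prodC B A A k l * g i j)
        + prodC B A A i k * g j l + prodC B A A j l * g i k + 2 * (A i k * A j l) := by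
  have h : ctr B (fun p q => kulkarniNomizu A g i p j k * A q l)
      = ctr B (fun r s => kulkarniNomizu A g j k i r * A l s) :=
    ctr_congr fun p q => by rw [kulkarniNomizu_pair hg hA, hA l q]
  rw [quadB_kulkarniNomizu hg, contr_kulkarniNomizu hg A, curvAct_kulkarniNomizu hg hA, h,
    ctr_kulkarniNomizu_mul hg, ctr_kulkarniNomizu_mul hg, prodC_comm hg A A l k]
  simp only [hA l k, hA k i, hA l j, hA j i, hg.apply_comm j i, hg.apply_comm l j,
    hg.apply_comm k i]
  ring

/-- B is bilinear, so B(W) splits into B(Riem), mixed terms and B(A ⊙ g). The mixed contractions `Y`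
of Riem with A on a single index cancel in the reaction combination, by antisymmetry in their first
two indices. -/
theorem reaction_kulkarniNomizu (hg : IsInverseMetric g B) (hR : IsAlgebraicCurvature R)
    (hA : ∀ i j, A i j = A j i) {W : Fin n → Fin n → Fin n → Fin n → ℝ}
    (hW : ∀ i j k l, W i j k l = R i j k l - kulkarniNomizu A g i j k l) (i j k l : Fin n) :
    reaction (quadB B W W) i j k l = reaction (quadB B R R) i j k l
      - kulkarniNomizu A (contr B R) i j k l - kulkarniNomizu (curvAct B R A) g i j k l
      + ((n : ℝ) - 2) / 2 * kulkarniNomizu A A i j k l + ctr B A * kulkarniNomizu A g i j k l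
      + ctr B (prodC B A A) / 2 * kulkarniNomizu g g i j k l
      - kulkarniNomizu (prodC B A A) g i j k l := by
  have e1 : ∀ i j k l, quadB B W W i j k l = quadB B R R i j k l
      - quadB B R (kulkarniNomizu A g) i j k l - quadB B R (kulkarniNomizu A g) k l i j
      + quadB B (kulkarniNomizu A g) (kulkarniNomizu A g) i j k l := by
    intro i j k l
    rw [IsAlgebraicCurvature.quadB_pair B hg.inv_symm R _ k l i j]
    simp only [quadB, ← ctr_sub, ← ctr_add]
    exact ctr_congr fun p q => ctr_congr fun r s => by rw [hW, hW]; ring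
  set Y : Fin n → Fin n → Fin n → Fin n → ℝ := fun a b c d => ctr B fun p q => R a b c p * A d q
    with hY
  have hY1 : ∀ a b c d, Y a b c d = -Y b a c d := by
    intro a b c d
    simp only [hY, ← ctr_neg]
    exact ctr_congr fun p q => by rw [hR.left a b]; ring
  have e2 : ∀ i j k l, quadB B R (kulkarniNomizu A g) i j k l = contr B R i j * A k l
      + curvAct B R A i j * g k l - Y i l j k - Y j k i l := by
    intro i j k l
    rw [quadB_kulkarniNomizu hg]
    congr 1
    exact ctr_congr fun p q => by rw [hR.pair, hA q l]
  have hs := hR.contr_symm hg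
  have hσ : ∀ a b, curvAct B R A a b = curvAct B R A b a := by
    intro a b
    rw [curvAct, curvAct, ctr_comm]
    exact ctr_congr fun p q => ctr_congr fun r s => by rw [hR.pair b p, hR.left, hR.right, hA]
  have hp := prodC_comm hg A A
  simp only [reaction, e1, e2, quadB_kulkarniNomizu_self hg hA]
  simp only [kulkarniNomizu]
  simp only [hY1 k i, hY1 l i, hY1 k j, hY1 l j, hs l k, hA l k, hg.apply_comm l k, hσ l k,
    hp l k]
  ring

/-- P acts as a derivation on both factors: it sends g to 2P, and A to AP + PA = 2AP since A and P
commute, which is what `hAP` expresses. -/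
theorem ricAct_kulkarniNomizu (hg : IsInverseMetric g B) (hA : ∀ i j, A i j = A j i)
    (hP : ∀ i j, P i j = P j i) (hAP : ∀ i j, prodC B A P i j = prodC B A P j i)
    (i j k l : Fin n) :
    ricAct B (kulkarniNomizu A g) P i j k l
      = 2 * kulkarniNomizu (prodC B A P) g i j k l + 2 * kulkarniNomizu A P i j k l := by
  have e4 : ∀ i j k l, ctr B (fun p q => kulkarniNomizu A g i j k p * P q l)
      = A i k * P l j + prodC B A P j l * g i k - prodC B A P i l * g j k - A j k * P l i := by
    intro i j k l
    rw [← ctr_kulkarniNomizu_mul hg]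
    exact ctr_congr fun p q => by rw [hP q l]
  have e3 : ctr B (fun p q => kulkarniNomizu A g i j p l * P q k)
      = -ctr B (fun p q => kulkarniNomizu A g i j l p * P q k) := by
    rw [← ctr_neg]
    exact ctr_congr fun p q => by rw [kulkarniNomizu_right A g i j p l]; ring
  have e2 : ctr B (fun p q => kulkarniNomizu A g i p k l * P q j)
      = ctr B (fun p q => kulkarniNomizu A g k l i p * P q j) :=
    ctr_congr fun p q => by rw [kulkarniNomizu_pair hg hA]
  have e1 : ctr B (fun p q => kulkarniNomizu A g p j k l * P q i)
      = -ctr B (fun p q => kulkarniNomizu A g k l j p * P q i) := by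
    rw [← ctr_neg]
    exact ctr_congr fun p q => by
      rw [kulkarniNomizu_pair hg hA, kulkarniNomizu_right A g k l p j]; ring
  simp only [ricAct, ctr_add]
  rw [e1, e2, e3, e4, e4, e4, e4]
  simp only [kulkarniNomizu, hA k i, hA k j, hA l i, hA l j, hP k i, hP k j, hP l i, hP l j,
    hAP k i, hAP k j, hAP l i, hAP l j, hg.apply_comm k i, hg.apply_comm k j, hg.apply_comm l i,
    hg.apply_comm l j]
  ring

end KulkarniNomizu

/-! ### Variation of Ricci, scalar and Weyl curvature at a point -/

section WeylVariation

variable {g B h V : Matrix (Fin n) (Fin n) ℝ} {R L S : Fin n → Fin n → Fin n → Fin n → ℝ}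
  {u : ℝ}

theorem curvAct_metric (hg : IsInverseMetric g B) (i k : Fin n) :
    curvAct B R g i k = contr B R i k :=
  ctr_congr fun p q => hg.ctr_mul_metric q fun r => R i p k r

theorem prodC_metric_left (hg : IsInverseMetric g B) (P : Matrix (Fin n) (Fin n) ℝ)
    (i k : Fin n) : prodC B g P i k = P k i := hg.ctr_metric_mul i (P k)

theorem prodC_metric_right (hg : IsInverseMetric g B) (P : Matrix (Fin n) (Fin n) ℝ)
    (i k : Fin n) : prodC B P g i k = P i k := hg.ctr_mul_metric k (P i)

theorem curvAct_linear (B P Q : Matrix (Fin n) (Fin n) ℝ)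
    (R : Fin n → Fin n → Fin n → Fin n → ℝ) (a b : ℝ) (i k : Fin n) :
    curvAct B R (fun i j => a * P i j + b * Q i j) i k
      = a * curvAct B R P i k + b * curvAct B R Q i k := by
  simp only [curvAct, ← ctr_mul_left, ← ctr_add]
  exact ctr_congr fun p q => ctr_congr fun r s => by ring

theorem prodC_linear_left (B P Q A : Matrix (Fin n) (Fin n) ℝ) (a b : ℝ) (i k : Fin n) :
    prodC B (fun i j => a * P i j + b * Q i j) A i k
      = a * prodC B P A i k + b * prodC B Q A i k := by
  simp only [prodC, ← ctr_mul_left, ← ctr_add]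
  exact ctr_congr fun p q => by ring

theorem prodC_linear_right (B P Q A : Matrix (Fin n) (Fin n) ℝ) (a b : ℝ) (i k : Fin n) :
    prodC B A (fun i j => a * P i j + b * Q i j) i k
      = a * prodC B A P i k + b * prodC B A Q i k := by
  simp only [prodC, ← ctr_mul_left, ← ctr_add]
  exact ctr_congr fun p q => by ring

theorem ctr_linear (B P Q : Matrix (Fin n) (Fin n) ℝ) (a b : ℝ) :
    ctr B (fun i j => a * P i j + b * Q i j) = a * ctr B P + b * ctr B Q := by
  simp only [ctr_add]
  exact congrArg₂ (· + ·) (ctr_mul_left B a P) (ctr_mul_left B b Q)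

theorem ctr_sandwich_curvAct (hg : IsInverseMetric g B) (i k : Fin n)
    (hh : ∀ i j, h i j = -2 * contr B R i j + u * g i j) :
    ctr (B * h * B) (fun j l => R i j k l)
      = -2 * curvAct B R (contr B R) i k + u * contr B R i k := by
  have e : h = fun i j => -2 * contr B R i j + u * g i j := by
    funext i j
    exact hh i j
  rw [ctr_sandwich hg.inv_symm, ← curvAct_metric hg (R := R), ← curvAct_linear, ← e]
  exact ctr_congr fun p q => ctr_congr fun r s => mul_comm _ _

theorem ctr_sandwich_contr (hg : IsInverseMetric g B)
    (hh : ∀ i j, h i j = -2 * contr B R i j + u * g i j) :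
    ctr (B * h * B) (contr B R)
      = -2 * ctr B (prodC B (contr B R) (contr B R)) + u * ctr B (contr B R) := by
  have e1 : ctr B (fun p q => ctr B fun r s => contr B R q s * contr B R p r)
      = ctr B (prodC B (contr B R) (contr B R)) :=
    ctr_congr fun p q => ctr_congr fun r s => mul_comm _ _
  have e2 : ctr B (fun p q => ctr B fun r s => g q s * contr B R p r) = ctr B (contr B R) := by
    refine ctr_congr fun p q => ?_
    rw [← hg.ctr_mul_metric q (contr B R p)]
    exact ctr_congr fun r s => mul_comm _ _
  refine (ctr_sandwich hg.inv_symm h (contr B R)).trans ?_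
  simp only [hh, add_mul, ctr_add, mul_assoc, ctr_mul_left]
  rw [e1, e2]

/-- The variation of the Ricci tensor. -/
theorem ricci_variation_eq (hg : IsInverseMetric g B) (hR : IsAlgebraicCurvature R)
    (hh : ∀ i j, h i j = -2 * contr B R i j + u * g i j)
    (hS : ∀ i j k l, S i j k l = L i j k l + 2 * reaction (quadB B R R) i j k l
        - ricAct B R (contr B R) i j k l + u * R i j k l
        - (1 / 2) * kulkarniNomizu V g i j k l) (i k : Fin n) :
    contr B S i k - ctr (B * h * B) (fun j l => R i j k l)
      = contr B L i k + 2 * curvAct B R (contr B R) i k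
        - 2 * prodC B (contr B R) (contr B R) i k
        - (1 / 2) * (((n : ℝ) - 2) * V i k + ctr B V * g i k) := by
  rw [ctr_sandwich_curvAct hg i k hh]
  have e : contr B S i k = contr B L i k
      + 2 * ctr B (fun j l => reaction (quadB B R R) i j k l)
      - ctr B (fun j l => ricAct B R (contr B R) i j k l) + u * contr B R i k
      - (1 / 2) * contr B (kulkarniNomizu V g) i k := by
    simp only [contr_apply, hS, ctr_sub, ctr_add, ctr_mul_left]
  rw [e, hR.ctr_ricAct hg, contr_kulkarniNomizu hg,
    show ctr B (fun j l => reaction (quadB B R R) i j k l) = curvAct B R (contr B R) i k from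
      hR.ctr_quadB hg i k]
  ring

/-- The variation of the scalar curvature. -/
theorem scalar_variation_eq (hg : IsInverseMetric g B) (hR : IsAlgebraicCurvature R)
    (hh : ∀ i j, h i j = -2 * contr B R i j + u * g i j) {dRic : Matrix (Fin n) (Fin n) ℝ}
    (hRic : ∀ i k, dRic i k = contr B L i k + 2 * curvAct B R (contr B R) i k
        - 2 * prodC B (contr B R) (contr B R) i k
        - (1 / 2) * (((n : ℝ) - 2) * V i k + ctr B V * g i k)) :
    ctr B dRic - ctr (B * h * B) (contr B R)
      = ctr B (contr B L) + 2 * ctr B (prodC B (contr B R) (contr B R)) - u * ctr B (contr B R)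
        - ((n : ℝ) - 1) * ctr B V := by
  rw [ctr_sandwich_contr hg hh]
  have e : ctr B dRic = ctr B (contr B L) + 2 * ctr B (curvAct B R (contr B R))
      - 2 * ctr B (prodC B (contr B R) (contr B R))
      - (1 / 2) * (((n : ℝ) - 2) * ctr B V + ctr B V * ctr B g) := by
    have e1 : ctr B dRic = ctr B fun i k => contr B L i k + 2 * curvAct B R (contr B R) i k
        - 2 * prodC B (contr B R) (contr B R) i k
        - (1 / 2) * (((n : ℝ) - 2) * V i k + ctr B V * g i k) := ctr_congr hRic
    have e2 : ∀ (X Y Z V g : Fin n → Fin n → ℝ) (a b : ℝ),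
        ctr B (fun i k => X i k + 2 * Y i k - 2 * Z i k - (1 / 2) * (a * V i k + b * g i k))
          = ctr B X + 2 * ctr B Y - 2 * ctr B Z - (1 / 2) * (a * ctr B V + b * ctr B g) := by
      intro X Y Z V g a b
      simp only [ctr_sub, ctr_add, ctr_mul_left]
    rw [e1]
    exact e2 _ _ _ _ _ _ _
  rw [e, hR.ctr_curvAct, hg.ctr_metric, show ctr B (prodC B (contr B R) (contr B R))
    = ctr B fun p q => ctr B fun r s => contr B R p r * contr B R q s from rfl]
  ring

/-- Three cancellations drive this: V and its trace drop out, since V ⊙ g has no Weyl part; Riem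
applied to Ric in the Ricci variation matches the mixed term of B(W); the rest is polynomial in Ric
and g. -/
theorem weyl_variation_eq (hn : 3 ≤ n) (hg : IsInverseMetric g B) (hR : IsAlgebraicCurvature R)
    (hh : ∀ i j, h i j = -2 * contr B R i j + u * g i j)
    (hS : ∀ i j k l, S i j k l = L i j k l + 2 * reaction (quadB B R R) i j k l
        - ricAct B R (contr B R) i j k l + u * R i j k l
        - (1 / 2) * kulkarniNomizu V g i j k l)
    {dRic : Matrix (Fin n) (Fin n) ℝ} {dScal : ℝ}
    (hRic : ∀ i k, dRic i k = contr B S i k - ctr (B * h * B) (fun j l => R i j k l))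
    (hScal : dScal = ctr B dRic - ctr (B * h * B) (contr B R))
    {W : Fin n → Fin n → Fin n → Fin n → ℝ}
    (hW : ∀ i j k l, W i j k l = R i j k l
      + ctr B (contr B R) / (((n : ℝ) - 1) * ((n : ℝ) - 2)) / 2 * kulkarniNomizu g g i j k l
      - 1 / ((n : ℝ) - 2) * kulkarniNomizu (contr B R) g i j k l) (i j k l : Fin n) :
    S i j k l + dScal / (((n : ℝ) - 1) * ((n : ℝ) - 2)) / 2 * kulkarniNomizu g g i j k l
      + ctr B (contr B R) / (((n : ℝ) - 1) * ((n : ℝ) - 2)) * kulkarniNomizu h g i j k l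
      - 1 / ((n : ℝ) - 2) * (kulkarniNomizu dRic g i j k l + kulkarniNomizu (contr B R) h i j k l)
    = L i j k l
      + ctr B (contr B L) / (((n : ℝ) - 1) * ((n : ℝ) - 2)) / 2 * kulkarniNomizu g g i j k l
      - 1 / ((n : ℝ) - 2) * kulkarniNomizu (contr B L) g i j k l
      + 2 * reaction (quadB B W W) i j k l
      + u * W i j k l
      - ricAct B W (contr B R) i j k l
      + 2 / ((n : ℝ) - 2) ^ 2 * kulkarniNomizu (prodC B (contr B R) (contr B R)) g i j k l
      + 1 / ((n : ℝ) - 2) * kulkarniNomizu (contr B R) (contr B R) i j k l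
      - 2 * ctr B (contr B R) / ((n : ℝ) - 2) ^ 2 * kulkarniNomizu (contr B R) g i j k l
      + (ctr B (contr B R) ^ 2 - ctr B (prodC B (contr B R) (contr B R)))
          / (((n : ℝ) - 1) * ((n : ℝ) - 2) ^ 2) * kulkarniNomizu g g i j k l := by
  have hs := hR.contr_symm hg
  have hRic' : ∀ i k, dRic i k = contr B L i k + 2 * curvAct B R (contr B R) i k
        - 2 * prodC B (contr B R) (contr B R) i k
        - (1 / 2) * (((n : ℝ) - 2) * V i k + ctr B V * g i k) := fun i k => by
    rw [hRic, ricci_variation_eq hg hR hh hS]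
  rw [scalar_variation_eq hg hR hh hRic'] at hScal
  -- The denominators n - 2 and n - 1 become x and x + 1, nonzero because n ≥ 3.
  obtain ⟨x, hx⟩ : ∃ x : ℝ, (n : ℝ) = x + 2 := ⟨n - 2, by ring⟩
  have hx0 : 1 ≤ x := by
    have : (3 : ℝ) ≤ n := by exact_mod_cast hn
    linarith
  set P : Matrix (Fin n) (Fin n) ℝ := contr B R with hP
  set s : ℝ := ctr B P with hsc
  -- The coefficients of the Schouten tensor A = e Ric + b g, chosen so that W = Riem - A ⊙ g; the
  -- factor ½ is there because g ⊙ g counts g_ik g_jl - g_il g_jk twice.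
  set b : ℝ := -(s / (((n : ℝ) - 1) * ((n : ℝ) - 2)) / 2) with hb
  set e : ℝ := 1 / ((n : ℝ) - 2) with he
  set A : Matrix (Fin n) (Fin n) ℝ := fun i j => e * P i j + b * g i j with hA
  have hAs : ∀ i j, A i j = A j i := fun i j => by
    simp only [hA]; rw [hs i j, hg.apply_comm i j]
  have hWA : ∀ i j k l, W i j k l = R i j k l - kulkarniNomizu A g i j k l := by
    intro i j k l
    rw [hW]
    simp only [hA, hb, kulkarniNomizu]
    ring
  have hPP : ∀ i j, prodC B P P i j = prodC B P P j i := prodC_comm hg P P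
  have hAP : ∀ i j, prodC B A P i j = e * prodC B P P i j + b * P i j := by
    intro i j
    rw [hA, prodC_linear_left, prodC_metric_left hg, hs j i]
  have hAA : ∀ i j, prodC B A A i j
      = e ^ 2 * prodC B P P i j + 2 * e * b * P i j + b ^ 2 * g i j := by
    intro i j
    have e1 : prodC B A A i j = e * prodC B A P i j + b * prodC B A g i j :=
      prodC_linear_right B P g A e b i j
    rw [e1, hAP, prodC_metric_right hg]
    simp only [hA]
    ring
  have hσ : ∀ i j, curvAct B R A i j = e * curvAct B R P i j + b * P i j := by
    intro i j
    rw [hA, curvAct_linear, curvAct_metric hg]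
  have htA : ctr B A = e * s + b * n := by
    rw [hA, ctr_linear, hg.ctr_metric]
  have htAA : ctr B (prodC B A A) = e ^ 2 * ctr B (prodC B P P) + 2 * e * b * s + b ^ 2 * n := by
    have e1 : ctr B (prodC B A A)
        = ctr B fun i j => e ^ 2 * prodC B P P i j + 2 * e * b * P i j + b ^ 2 * g i j :=
      ctr_congr hAA
    rw [e1, ctr_add, ctr_linear, show ctr B (fun i j => b ^ 2 * g i j) = b ^ 2 * ctr B g from
      ctr_mul_left B _ g, hg.ctr_metric]
  have hact : ricAct B W P i j k l = ricAct B R P i j k l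
      - ricAct B (kulkarniNomizu A g) P i j k l := by
    simp only [ricAct, ← ctr_sub]
    exact ctr_congr fun p q => by simp only [hWA]; ring
  rw [hact, ricAct_kulkarniNomizu hg hAs hs (fun i j => by rw [hAP, hAP, hPP, hs]),
    reaction_kulkarniNomizu hg hR hAs hWA, hWA, hS, hScal, htA, htAA]
  -- The surviving contractions enter only as scalars; made opaque, they leave a rational identity
  -- in x and the matrix entries.
  generalize reaction (quadB B R R) i j k l = r0
  generalize ricAct B R P i j k l = r1
  generalize ctr B (prodC B P P) = N
  generalize ctr B (contr B L) = sL
  have hA' : ∀ i j, A i j = e * P i j + b * g i j := fun _ _ => rfl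
  simp only [kulkarniNomizu, hRic', hAP, hAA, hσ, hA', hh, ← hP]
  generalize ctr B V = v
  simp only [he, hb, hx]
  have hx1 : x ≠ 0 := by linarith
  have hx2 : x + 1 ≠ 0 := by linarith
  have hx3 : x + 2 - 1 = x + 1 := by ring
  have hx4 : x + 2 - 2 = x := by ring
  rw [hx3, hx4]
  field_simp
  ring

end WeylVariation

/-! ### The pointwise algebra applied to the curvature of a metric field -/

open Matrix

namespace IsMetricOn

variable {U : Set (EuclideanSpace ℝ (Fin n))}
  {G : EuclideanSpace ℝ (Fin n) → Matrix (Fin n) (Fin n) ℝ} {y : EuclideanSpace ℝ (Fin n)}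

theorem isInverseMetric (hG : IsMetricOn G U) (hy : y ∈ U) :
    IsInverseMetric (G y) (G y)⁻¹ :=
  ⟨hG.symm y hy, hG.inv_symm hy, hG.mul_inv hy⟩

theorem isAlgebraicCurvature (hG : IsMetricOn G U) (hy : y ∈ U) :
    IsAlgebraicCurvature (riem G y) :=
  ⟨riem_antisymm_left y, hG.riem_antisymm_right hy, hG.riem_pair_symm hy, hG.riem_bianchi hy⟩

theorem act4_curv (hG : IsMetricOn G U) (hy : y ∈ U)
    (X : Fin n → Fin n → Fin n → Fin n → ℝ) (p q i j k l : Fin n) :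
    act4 (curv G p q y) X i j k l = ctr (G y)⁻¹ fun s r => riem G y p q i r * X s j k l
      + riem G y p q j r * X i s k l + riem G y p q k r * X i j s l
      + riem G y p q l r * X i j k s := by
  have e : ∀ m a, curv G p q y m a = ∑ r, (G y)⁻¹ m r * riem G y p q a r := by
    intro m a
    have e : curv G p q y = (G y)⁻¹ * (G y * curv G p q y) := by
      rw [← mul_assoc, hG.inv_mul hy, one_mul]
    exact congrFun (congrFun e m) a
  simp only [act4, ctr, e, Finset.sum_mul, ← Finset.sum_add_distrib]
  exact Finset.sum_congr rfl fun _ _ => Finset.sum_congr rfl fun _ _ => by ring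

theorem isSecondDerivative (hG : IsMetricOn G U) (hy : y ∈ U) :
    IsSecondDerivative (G y)⁻¹ (riem G y) (hess4 G (riem G) y) where
  left := hG.hess4_antisymm_left hy fun _ _ => riem_antisymm_left _
  right := hG.hess4_antisymm_right hy fun _ hz => hG.riem_antisymm_right hz
  pair := hG.hess4_pair_symm hy fun _ hz => hG.riem_pair_symm hz
  bianchi := hG.hess4_riem_bianchi hy
  comm p q i j k l := by
    rw [hG.hess4_commutator hy hG.smooth_riem, hG.act4_curv hy]

theorem smooth_ric (hG : IsMetricOn G U) : SmoothMat U (ric G) :=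
  hG.smooth_contr hG.smooth_riem

theorem contDiffOn_scal (hG : IsMetricOn G U) : ContDiffOn ℝ ∞ (scal G) U :=
  hG.contDiffOn_ctr hG.smooth_ric

theorem hess0_comm (hG : IsMetricOn G U) (hy : y ∈ U) {f : EuclideanSpace ℝ (Fin n) → ℝ}
    (hf : ContDiffOn ℝ ∞ f U) (p q : Fin n) : hess0 G f y p q = hess0 G f y q p := by
  rw [hess0, hess0, pd_comm hG.isOpen hf hy]
  simp only [hG.christoffel_comm hy _ p q]

theorem hess2_ric (hG : IsMetricOn G U) (hy : y ∈ U) (p q : Fin n) :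
    hess2 G (ric G) y p q = contr (G y)⁻¹ (hess4 G (riem G) y p q) :=
  hG.hess2_contr hy hG.smooth_riem p q

theorem hess0_scal (hG : IsMetricOn G U) (hy : y ∈ U) (p q : Fin n) :
    hess0 G (scal G) y p q = ctr (G y)⁻¹ (contr (G y)⁻¹ (hess4 G (riem G) y p q)) := by
  rw [← hG.hess2_ric hy]
  exact hG.hess0_ctr hy hG.smooth_ric p q

theorem smooth_smul_metric (hG : IsMetricOn G U) {f : EuclideanSpace ℝ (Fin n) → ℝ}
    (hf : ContDiffOn ℝ ∞ f U) : SmoothMat U (fun z => f z • G z) :=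
  fun i j => hf.mul (hG.smooth i j)

/-- The metric is parallel, so Δ passes through the traces and through ⊙ g: ΔW is the Weyl
combination formed from ΔRiem. -/
theorem laplacian_weylField (hG : IsMetricOn G U) (hy : y ∈ U) (i j k l : Fin n) :
    laplacian G (weylField G) y ![i, j, k, l]
      = ctr (G y)⁻¹ (fun p q => hess4 G (riem G) y p q i j k l)
        + ctr (G y)⁻¹ (contr (G y)⁻¹ fun i j k l =>
              ctr (G y)⁻¹ fun p q => hess4 G (riem G) y p q i j k l)
            / (((n : ℝ) - 1) * ((n : ℝ) - 2)) / 2 * kulkarniNomizu (G y) (G y) i j k l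
        - 1 / ((n : ℝ) - 2) * kulkarniNomizu (contr (G y)⁻¹ fun i j k l =>
              ctr (G y)⁻¹ fun p q => hess4 G (riem G) y p q i j k l) (G y) i j k l := by
  -- With this constant, S = Ric - R g/(2(n-1)) is n - 2 times the Schouten tensor, and W = Riem - e
  -- S ⊙ g.
  set a : ℝ := -(1 / (2 * ((n : ℝ) - 1))) with ha
  set e : ℝ := 1 / ((n : ℝ) - 2) with he
  set S : EuclideanSpace ℝ (Fin n) → Matrix (Fin n) (Fin n) ℝ :=
    fun z => (1 : ℝ) • ric G z + a • (scal G z • G z) with hS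
  have hsg := hG.smooth_smul_metric hG.contDiffOn_scal
  have hSs : SmoothMat U S := fun b c =>
    (contDiffOn_const.mul (hG.smooth_ric b c)).add (contDiffOn_const.mul (hsg b c))
  have h1 : ∀ z ∈ U, ∀ i j k l, weyl G z i j k l
      = riem G z i j k l + (-e) * kulkarniNomizu (S z) (G z) i j k l := by
    intro z _ i j k l
    simp only [weyl, hS, kulkarniNomizu, ha, he, Matrix.add_apply, Matrix.smul_apply, smul_eq_mul,
      div_eq_mul_inv, _root_.mul_inv]
    ring
  have h2 : ∀ p q, hess4 G (weyl G) y p q i j k l = hess4 G (riem G) y p q i j k l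
      - e * (kulkarniNomizu (contr (G y)⁻¹ (hess4 G (riem G) y p q)) (G y) i j k l
        + a * (ctr (G y)⁻¹ (contr (G y)⁻¹ (hess4 G (riem G) y p q))
          * kulkarniNomizu (G y) (G y) i j k l)) := by
    intro p q
    rw [hG.hess4_congr hy h1,
      hG.hess4_add_const_mul hy hG.smooth_riem (hG.smooth_kulkarniNomizu hSs) (-e),
      hG.hess4_kulkarniNomizu hy hSs, hG.hess2_linear hy hG.smooth_ric hsg, hG.hess2_ric hy,
      hG.hess2_smul_metric hy hG.contDiffOn_scal, hG.hess0_scal hy]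
    simp only [kulkarniNomizu, Matrix.add_apply, Matrix.smul_apply, smul_eq_mul]
    ring
  have h3 : ∀ a b, ctr (G y)⁻¹ (fun p q => contr (G y)⁻¹ (hess4 G (riem G) y p q) a b)
      = contr (G y)⁻¹ (fun i j k l =>
          ctr (G y)⁻¹ fun p q => hess4 G (riem G) y p q i j k l) a b := by
    intro a b
    simp only [contr_apply]
    rw [ctr_comm]
  have h4 : ctr (G y)⁻¹ (fun p q => ctr (G y)⁻¹ (contr (G y)⁻¹ (hess4 G (riem G) y p q)))
      = ctr (G y)⁻¹ (contr (G y)⁻¹ fun i j k l =>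
          ctr (G y)⁻¹ fun p q => hess4 G (riem G) y p q i j k l) :=
    (ctr_comm _ _ fun p q a b => contr (G y)⁻¹ (hess4 G (riem G) y p q) a b).trans
      (ctr_congr h3)
  have h5 : ctr (G y)⁻¹ (fun p q =>
      kulkarniNomizu (contr (G y)⁻¹ (hess4 G (riem G) y p q)) (G y) i j k l)
      = kulkarniNomizu (contr (G y)⁻¹ fun i j k l =>
          ctr (G y)⁻¹ fun p q => hess4 G (riem G) y p q i j k l) (G y) i j k l := by
    simp only [kulkarniNomizu, ctr_add, ctr_sub, ctr_mul_right, h3]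
  rw [show laplacian G (weylField G) y ![i, j, k, l] = _ from
    laplacian_eq_ctr_hess4 G (weyl G) y i j k l, ctr_congr h2, ctr_sub, ctr_mul_left, ctr_add,
    ctr_mul_left, ctr_mul_right, h4, h5]
  simp only [ha, he, div_eq_mul_inv, _root_.mul_inv]
  ring

end IsMetricOn

theorem weylB_eq (G : EuclideanSpace ℝ (Fin n) → Matrix (Fin n) (Fin n) ℝ)
    (y : EuclideanSpace ℝ (Fin n)) (i j k l : Fin n) :
    weylB G y i j k l = quadB (G y)⁻¹ (weyl G y) (weyl G y) i j k l := by
  simp only [weylB, quadB, ctr, Finset.mul_sum, mul_assoc]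

theorem ricSq_eq (G : EuclideanSpace ℝ (Fin n) → Matrix (Fin n) (Fin n) ℝ)
    (y : EuclideanSpace ℝ (Fin n)) : ricSq G y = prodC (G y)⁻¹ (ric G y) (ric G y) := by
  ext a b
  simp only [ricSq, prodC, ctr, mul_assoc]

theorem normRicSq_eq (G : EuclideanSpace ℝ (Fin n) → Matrix (Fin n) (Fin n) ℝ)
    (y : EuclideanSpace ℝ (Fin n)) :
    normRicSq G y = ctr (G y)⁻¹ (prodC (G y)⁻¹ (ric G y) (ric G y)) := by
  simp only [normRicSq, ctr, prodC, Finset.mul_sum, mul_assoc]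
  exact Finset.sum_congr rfl fun i _ => Finset.sum_comm

theorem weyl_eq (G : EuclideanSpace ℝ (Fin n) → Matrix (Fin n) (Fin n) ℝ)
    (y : EuclideanSpace ℝ (Fin n)) (i j k l : Fin n) :
    weyl G y i j k l = riem G y i j k l
      + scal G y / (((n : ℝ) - 1) * ((n : ℝ) - 2)) / 2 * kulkarniNomizu (G y) (G y) i j k l
      - 1 / ((n : ℝ) - 2) * kulkarniNomizu (ric G y) (G y) i j k l := by
  simp only [weyl, kulkarniNomizu]
  ring

theorem HasDerivWithinAt.kulkarniNomizu {J : Set ℝ} {t : ℝ}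
    {P Q : ℝ → Matrix (Fin n) (Fin n) ℝ} {P' Q' : Matrix (Fin n) (Fin n) ℝ}
    (hP : ∀ i j, HasDerivWithinAt (fun s => P s i j) (P' i j) J t)
    (hQ : ∀ i j, HasDerivWithinAt (fun s => Q s i j) (Q' i j) J t) (i j k l : Fin n) :
    HasDerivWithinAt (fun s => kulkarniNomizu (P s) (Q s) i j k l)
      (kulkarniNomizu P' (Q t) i j k l + kulkarniNomizu (P t) Q' i j k l) J t := by
  have h := ((((hP i k).fun_mul (hQ j l)).fun_add ((hP j l).fun_mul (hQ i k))).fun_sub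
    ((hP i l).fun_mul (hQ j k))).fun_sub ((hP j k).fun_mul (hQ i l))
  refine h.congr_deriv ?_
  simp only [RBFlow.kulkarniNomizu]
  ring

/-- The evolution of the Weyl tensor in a coordinate domain. -/
theorem IsMetricFamilyOn.hasDerivWithinAt_weyl (hn : 3 ≤ n) {J : Set ℝ}
    {U : Set (EuclideanSpace ℝ (Fin n))}
    {G : ℝ → EuclideanSpace ℝ (Fin n) → Matrix (Fin n) (Fin n) ℝ} (hG : IsMetricFamilyOn G J U)
    {t : ℝ} (ht : t ∈ J) (ρ : ℝ)
    (hflow : ∀ z ∈ U, ∀ i j, HasDerivWithinAt (fun s => G s z i j)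
      (-2 * ric (G t) z i j + 2 * ρ * scal (G t) z * G t z i j) J t)
    {y : EuclideanSpace ℝ (Fin n)} (hy : y ∈ U) (i j k l : Fin n) :
    HasDerivWithinAt (fun s => weyl (G s) y i j k l)
      (laplacian (G t) (weylField (G t)) y ![i, j, k, l]
        + 2 * reaction (weylB (G t) y) i j k l
        + 2 * ρ * scal (G t) y * weyl (G t) y i j k l
        - ricAct (G t y)⁻¹ (weyl (G t) y) (ric (G t) y) i j k l
        + 2 / ((n : ℝ) - 2) ^ 2 * kulkarniNomizu (ricSq (G t) y) (G t y) i j k l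
        + 1 / ((n : ℝ) - 2) * kulkarniNomizu (ric (G t) y) (ric (G t) y) i j k l
        - 2 * scal (G t) y / ((n : ℝ) - 2) ^ 2
          * kulkarniNomizu (ric (G t) y) (G t y) i j k l
        + (scal (G t) y ^ 2 - normRicSq (G t) y) / (((n : ℝ) - 1) * ((n : ℝ) - 2) ^ 2)
            * kulkarniNomizu (G t y) (G t y) i j k l) J t := by
  have hM := hG.isMetricOn ht
  have hI := hM.isInverseMetric hy
  have hR := hM.isAlgebraicCurvature hy
  have hD := hM.isSecondDerivative hy
  set f : EuclideanSpace ℝ (Fin n) → ℝ := fun z => 2 * ρ * scal (G t) z with hf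
  have hfs : ContDiffOn ℝ ∞ f U := contDiffOn_const.mul hM.contDiffOn_scal
  -- The idle coefficient 1 gives h the shape required by `hess2_linear`.
  set h : EuclideanSpace ℝ (Fin n) → Matrix (Fin n) (Fin n) ℝ :=
    fun z => (-2 : ℝ) • ric (G t) z + (1 : ℝ) • (f z • G t z) with hh
  have hsm : SmoothMat U h := fun a b =>
    (contDiffOn_const.mul (hM.smooth_ric a b)).add
      (contDiffOn_const.mul (hM.smooth_smul_metric hfs a b))
  have hhz : ∀ z i j, h z i j = -2 * ric (G t) z i j + f z * G t z i j := by
    intro z i j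
    simp only [hh, Matrix.add_apply, Matrix.smul_apply, smul_eq_mul]
    ring
  have hsymm : ∀ z ∈ U, (h z)ᵀ = h z := by
    intro z hz
    ext a b
    rw [Matrix.transpose_apply, hhz, hhz, hM.apply_comm hz,
      show ric (G t) z b a = ric (G t) z a b from
        (hM.isAlgebraicCurvature hz).contr_symm (hM.isInverseMetric hz) b a]
  have hder : ∀ z ∈ U, ∀ i j, HasDerivWithinAt (fun s => G s z i j) (h z i j) J t := by
    intro z hz i j
    rw [hhz]
    exact hflow z hz i j
  have hH : ∀ p q i j, hess2 (G t) h y p q i j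
      = -2 * contr (G t y)⁻¹ (hess4 (G t) (riem (G t)) y p q) i j
        + hess0 (G t) f y p q * G t y i j := by
    intro p q i j
    rw [hM.hess2_linear hy hM.smooth_ric (hM.smooth_smul_metric hfs), hM.hess2_ric hy,
      hM.hess2_smul_metric hy hfs]
    simp only [Matrix.add_apply, Matrix.smul_apply, smul_eq_mul]
    ring
  have dR := fun i j k l => hG.hasDerivWithinAt_riem ht hder hsymm hsm hy i j k l
  have dRic : ∀ i k, HasDerivWithinAt (fun s => ric (G s) y i k) _ J t := fun i k =>
    hG.hasDerivWithinAt_ctr ht hy (hder y hy) (X := fun s j l => riem (G s) y i j k l)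
      fun j l => dR i j k l
  have dScal : HasDerivWithinAt (fun s => scal (G s) y) _ J t :=
    hG.hasDerivWithinAt_ctr ht hy (hder y hy) (X := fun s => ric (G s) y) dRic
  have hS : ∀ i j k l, varRiem (G t) h y i j k l
      = ctr (G t y)⁻¹ (fun p q => hess4 (G t) (riem (G t)) y p q i j k l)
        + 2 * reaction (quadB (G t y)⁻¹ (riem (G t) y) (riem (G t) y)) i j k l
        - ricAct (G t y)⁻¹ (riem (G t) y) (contr (G t y)⁻¹ (riem (G t) y)) i j k l
        + f y * riem (G t) y i j k l
        - (1 / 2) * kulkarniNomizu (hess0 (G t) f y) (G t y) i j k l := fun i j k l =>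
    hD.variation_eq hR hI (f y) (V := hess0 (G t) f y) (fun p q => hM.hess0_comm hy hfs p q)
      (hhz y) hH i j k l
  have key := weyl_variation_eq hn hI hR (hhz y) hS
    (dRic := fun i k => contr (G t y)⁻¹ (varRiem (G t) h y) i k
      - ctr ((G t y)⁻¹ * h y * (G t y)⁻¹) (fun j l => riem (G t) y i j k l))
    (fun _ _ => rfl) rfl (weyl_eq (G t) y) i j k l
  have dW := ((dR i j k l).fun_add (((dScal.div_const (((n : ℝ) - 1) * ((n : ℝ) - 2))).div_const
    2).fun_mul (HasDerivWithinAt.kulkarniNomizu (hder y hy) (hder y hy) i j k l))).fun_sub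
    ((HasDerivWithinAt.kulkarniNomizu dRic (hder y hy) i j k l).const_mul (1 / ((n : ℝ) - 2)))
  simp only [← weyl_eq] at dW
  refine dW.congr_deriv ?_
  rw [hM.laplacian_weylField hy, ricSq_eq, normRicSq_eq,
    show reaction (weylB (G t) y) i j k l
      = reaction (quadB (G t y)⁻¹ (weyl (G t) y) (weyl (G t) y)) i j k l by
        simp only [reaction, weylB_eq]]
  refine Eq.trans ?_ key
  have hc : kulkarniNomizu (G t y) (h y) i j k l = kulkarniNomizu (h y) (G t y) i j k l := by
    simp only [kulkarniNomizu]; ring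
  rw [hc, show scal (G t) y = ctr (G t y)⁻¹ (contr (G t y)⁻¹ (riem (G t) y)) from rfl,
    show ric (G t) y = contr (G t y)⁻¹ (riem (G t) y) from rfl]
  have hfun : contr (G t y)⁻¹ (varRiem (G t) h y) = fun i k => ctr (G t y)⁻¹ fun j l =>
    varRiem (G t) h y i j k l := rfl
  rw [hfun]
  ring

/-! ### From a chart of the manifold to a family of metric matrices -/

section Manifold

variable {M : Type*} [TopologicalSpace M] [ChartedSpace (EuclideanSpace ℝ (Fin n)) M]
  [IsManifold (𝓡 n) ∞ M]

/-- A kernel vector v of the Gram matrix gives V = v^i ∂_i with g(V, V) = 0, so V = 0 by positivity,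
and v = 0 because the differential of the inverse chart is injective. -/
theorem isUnit_det_metricCoord (g : SmoothMetric n M)
    {φ : OpenPartialHomeomorph M (EuclideanSpace ℝ (Fin n))}
    (hφ : φ ∈ IsManifold.maximalAtlas (𝓡 n) ∞ M) {y : EuclideanSpace ℝ (Fin n)}
    (hy : y ∈ φ.target) : IsUnit (metricCoord g φ y).det := by
  have hd : φ.MDifferentiable (𝓡 n) (𝓡 n) :=
    ⟨(contMDiffOn_of_mem_maximalAtlas hφ).mdifferentiableOn (by simp),
      (contMDiffOn_symm_of_mem_maximalAtlas hφ).mdifferentiableOn (by simp)⟩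
  have hinj := hd.symm.mfderiv_injective (x := y) hy
  rw [isUnit_iff_ne_zero]
  intro h0
  obtain ⟨v, hv, hv0⟩ := Matrix.exists_mulVec_eq_zero_iff.2 h0
  set w : EuclideanSpace ℝ (Fin n) := ∑ i, v i • EuclideanSpace.single i (1 : ℝ) with hw
  set V : TangentSpace (𝓡 n) (φ.symm y) := mfderiv (𝓡 n) (𝓡 n) φ.symm y w with hV
  have hVs : V = ∑ i, v i • coordVec φ y i := by
    rw [hV, hw]
    -- The tangent space agrees with the model space only by unfolding, hence `erw`.
    erw [map_sum]
    refine Finset.sum_congr rfl fun i _ => ?_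
    erw [map_smul]
    rfl
  have hz : g.inner (φ.symm y) V V = 0 := by
    have h1 : g.inner (φ.symm y) V V = ∑ i, v i * (metricCoord g φ y *ᵥ v) i := by
      rw [hVs]
      simp only [map_sum, map_smul, _root_.sum_apply, _root_.smul_apply,
        smul_eq_mul, Matrix.mulVec, dotProduct, metricCoord, Finset.mul_sum]
      rw [Finset.sum_comm]
      exact Finset.sum_congr rfl fun _ _ => Finset.sum_congr rfl fun _ _ => by ring
    rw [h1, hv0]
    simp
  have hV0 : V = 0 := by
    by_contra hne
    exact (g.pos (φ.symm y) V hne).ne' hz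
  have hw0 : w = 0 := hinj (by rw [← hV, hV0]; exact (map_zero _).symm)
  apply hv
  funext i
  have := congrArg (fun u : EuclideanSpace ℝ (Fin n) => u i) hw0
  simpa [hw, Pi.single_apply] using this

theorem isMetricFamilyOn_metricCoord {ρ : ℝ} {J : Set ℝ} (hJ : J.OrdConnected)
    (hJ' : J.Nontrivial) {g : ℝ → SmoothMetric n M} (hg : IsRBFlow ρ J g)
    {φ : OpenPartialHomeomorph M (EuclideanSpace ℝ (Fin n))}
    (hφ : φ ∈ IsManifold.maximalAtlas (𝓡 n) ∞ M) :
    IsMetricFamilyOn (fun s => metricCoord (g s) φ) J φ.target where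
  ordConnected := hJ
  nontrivial := hJ'
  isOpen := φ.open_target
  smooth := hg.smooth φ hφ
  symm s _ y _ := by
    ext a b
    exact (g s).symm _ _ _
  det s _ y hy := isUnit_det_metricCoord (g s) hφ hy

end Manifold

end RBFlow

end

theorem mainTheorem11 {n : ℕ} (hn : 3 ≤ n)
    {M : Type*} [TopologicalSpace M] [ChartedSpace (EuclideanSpace ℝ (Fin n)) M]
    [IsManifold (𝓡 n) ∞ M]
    (ρ : ℝ) (J : Set ℝ) (hJ : J.OrdConnected) (hJ' : J.Nontrivial)
    (g : ℝ → RBFlow.SmoothMetric n M) (hg : RBFlow.IsRBFlow ρ J g)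
    (φ : OpenPartialHomeomorph M (EuclideanSpace ℝ (Fin n)))
    (hφ : φ ∈ IsManifold.maximalAtlas (𝓡 n) ∞ M)
    (t : ℝ) (ht : t ∈ J) (y : EuclideanSpace ℝ (Fin n)) (hy : y ∈ φ.target)
    (i j k l : Fin n) :
    let G : EuclideanSpace ℝ (Fin n) → Matrix (Fin n) (Fin n) ℝ := RBFlow.metricCoord (g t) φ
    let W := RBFlow.weyl G y
    let B := RBFlow.weylB G y
    let Ric := RBFlow.ric G y
    let R := RBFlow.scal G y
    HasDerivWithinAt (fun s => RBFlow.weyl (RBFlow.metricCoord (g s) φ) y i j k l)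
      (RBFlow.laplacian G (RBFlow.weylField G) y ![i, j, k, l]
        + 2 * (B i j k l - B i j l k - B i l j k + B i k j l)
        + 2 * ρ * R * W i j k l
        - ∑ p, ∑ q, (G y)⁻¹ p q *
            (W p j k l * Ric q i + W i p k l * Ric q j + W i j p l * Ric q k + W i j k p * Ric q l)
        + 2 / ((n : ℝ) - 2) ^ 2 * RBFlow.kulkarniNomizu (RBFlow.ricSq G y) (G y) i j k l
        + 1 / ((n : ℝ) - 2) * RBFlow.kulkarniNomizu Ric Ric i j k l
        - 2 * R / ((n : ℝ) - 2) ^ 2 * RBFlow.kulkarniNomizu Ric (G y) i j k l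
        + (R ^ 2 - RBFlow.normRicSq G y) / (((n : ℝ) - 1) * ((n : ℝ) - 2) ^ 2)
            * RBFlow.kulkarniNomizu (G y) (G y) i j k l)
      J t :=
  (RBFlow.isMetricFamilyOn_metricCoord hJ hJ' hg hφ).hasDerivWithinAt_weyl hn ht ρ
    (fun z hz a b => hg.evolution φ hφ t ht z hz a b) hy i j k l
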